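/- Let $K$ be a field and $V$ a $K$-vector space. *Words and blocks.* A cut of a pair of words $(u_1\cdots u_p,\,v_1\cdots v_q)$ into $k$ blocks is given by integers $i_s,j_s\ge 0$ with $i_1+\cdots+i_k=p$, $j_1+\cdots+j_k=q$; its $s$-th block is the pair formed by the $s$-th consecutive subword of length $i_s$ of $u$ and the $s$-th consecutive subword of length $j_s$ of $v$. Given operations $M_{ij}$, write $M_{i_1j_1}\cdots M_{i_kj_k}(u,v)$ for the word of length $k$ whose letters are the values of $M_{i_sj_s}$ on the blocks. *$B_\infty$-algebras.* A $B_\infty$-algebra is a vector space $R$ with linear maps $M_{pq}:R^{\otimes p}\otimes R^{\otimes q}\to R$ ($p,q\ge 0$) such that $M_{00}=0$, $M_{10}=M_{01}=\mathrm{Id}_R$, $M_{n0}=M_{0n}=0$ for $n\ge 2$, and, for all words $u,v,w$ of lengths $i,j,k\ge 1$, $$\sum_{1\le l\le i+j}\ \sum M_{lk}\big(M_{i_1j_1}\cdots M_{i_lj_l}(u,v),\,w\big)=\sum_{1\le m\le j+k}\ \sum M_{im}\big(u,\,M_{j_1k_1}\cdots M_{j_mk_m}(v,w)\big),$$ the inner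 sums being over all cuts of $(u,v)$ into $l$ blocks, respectively of $(v,w)$ into $m$ blocks. Homomorphisms are the linear maps commuting with all $M_{pq}$. $B_\infty(V)$ denotes the free $B_\infty$-algebra on $V$. *2-associative bialgebras.* A (unital) 2-associative algebra is a vector space with two associative products $*$ and $\cdot$ having a common unit $1$; $2as(V)$ denotes the free one on $V$. A 2-associative bialgebra $(\mathcal H,*,\cdot,\Delta)$ is a 2-associative algebra with a counital coassociative coproduct $\Delta$ such that $(\mathcal H,*,\Delta)$ is a bialgebra and $\Delta(x\cdot y)=(x\otimes 1)\cdot\Delta(y)+\Delta(x)\cdot(1\otimes y)-x\otimes y$; $\mathrm{Prim}\,\mathcal H$ is the space of $x$ with $\Delta(x)=x\otimes1+1\otimes x$. On $2as(V)$ one takes the coproduct determined by $\Delta(1)=1\otimes 1$, $\Delta(v)=v\otimes1+1\otimes v$ for $v\in V$, and the above compatibilities with $*$ and $\cdot$. Every 2-associative algebra carries operations $M_{pq}$ defined by induction on $p+q$: $M_{00}=0$, $M_{10}=M_{01}=\mathrm{Id}$, $M_{n0}=M_{0n}=0$ for $n\ge2$, and, for $p,q\ge1$, $M_{pq}(u_1\cdots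 u_p,v_1\cdots v_q)$ is $(u_1\cdot\ldots\cdot u_p)*(v_1\cdot\ldots\cdot v_q)$ minus the sum, over all $k\ge2$ and all cuts into $k$ blocks other than the empty block $(i_s,j_s)=(0,0)$, of the $\cdot$-products of the letters of $M_{i_1j_1}\cdots M_{i_kj_k}(u_1\cdots u_p,v_1\cdots v_q)$. *$T^{fc}(R)$.* For a $B_\infty$-algebra $R$, $T^{fc}(R)$ is the tensor module $\bigoplus_{n\ge0}R^{\otimes n}$ with the concatenation product $\cdot$, the deconcatenation coproduct $\Delta(u_1\cdots u_n)=\sum_{i=0}^n u_1\cdots u_i\otimes u_{i+1}\cdots u_n$, the projection onto $R^{\otimes 0}=K$ as counit, and the product $*$ with unit $1\in R^{\otimes 0}$ for which $u_1\cdots u_p*v_1\cdots v_q=\sum_{k\ge1}\sum M_{i_1j_1}\cdots M_{i_kj_k}(u_1\cdots u_p,v_1\cdots v_q)$ when $p+q\ge1$, the inner sum being over all cuts into $k$ blocks. **Corollary 4.4.** $2as(V)$ and $T^{fc}(B_\infty(V))$ are 2-associative bialgebras, the subspace $\mathrm{Prim}(2as(V))$ is closed under the operations $M_{pq}$ of $2as(V)$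 and is a $B_\infty$-algebra under them, and there are an isomorphism of $B_\infty$-algebras and an isomorphism of 2-associative bialgebras $$\bar\phi:\mathrm{Prim}(2as(V))\cong B_\infty(V),\qquad \phi:2as(V)\cong T^{fc}(B_\infty(V)),$$ such that $\phi(v)=v$ for all $v\in V$ and $\phi(x)=\bar\phi(x)\in B_\infty(V)\subset T^{fc}(B_\infty(V))$ for all $x\in\mathrm{Prim}(2as(V))$. -/

import Mathlib

open scoped TensorProduct

universe u v w

noncomputable section

/-! ## Unital 2-associative algebras and bialgebras -/

/-- The operations of a unital 2-associative algebra on `A`: two bilinear products and a common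
unit, not yet subject to any law. -/
structure TwoAssocData (K : Type u) (A : Type v) [Field K] [AddCommGroup A] [Module K A] where
  one : A
  /-- the product `x * y` -/
  star : A →ₗ[K] A →ₗ[K] A
  /-- the product `x · y` -/
  dot : A →ₗ[K] A →ₗ[K] A

/-- The laws of a unital 2-associative algebra. -/
structure TwoAssocData.IsAlgebra {K : Type u} {A : Type v} [Field K] [AddCommGroup A] [Module K A]
    (O : TwoAssocData K A) : Prop where
  star_assoc : ∀ a b c, O.star (O.star a b) c = O.star a (O.star b c)
  one_star : ∀ a, O.star O.one a = a
  star_one : ∀ a, O.star a O.one = a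
  dot_assoc : ∀ a b c, O.dot (O.dot a b) c = O.dot a (O.dot b c)
  one_dot : ∀ a, O.dot O.one a = a
  dot_one : ∀ a, O.dot a O.one = a

/-- Homomorphisms of unital 2-associative algebras. -/
structure TwoAssocData.IsHom {K : Type u} {A : Type v} {B : Type w} [Field K]
    [AddCommGroup A] [Module K A] [AddCommGroup B] [Module K B]
    (O : TwoAssocData K A) (P : TwoAssocData K B) (f : A →ₗ[K] B) : Prop where
  map_one : f O.one = P.one
  map_star : ∀ a b, f (O.star a b) = P.star (f a) (f b)
  map_dot : ∀ a b, f (O.dot a b) = P.dot (f a) (f b)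

/-- Two products, a unit, a coproduct and a counit on `H`, not yet subject to any law. -/
structure TwoAssocBialgData (K : Type u) (H : Type v) [Field K] [AddCommGroup H] [Module K H]
    extends TwoAssocData K H where
  comul : H →ₗ[K] H ⊗[K] H
  counit : H →ₗ[K] K

/-- The laws of a 2-associative bialgebra: `(H, *, Δ)` is a bialgebra and `(H, ·, Δ)` is a
unital infinitesimal bialgebra. For a bilinear product `m` on `H`, the map
`TensorProduct.map₂ m m` is the componentwise product `(x ⊗ y)(x' ⊗ y') = m x x' ⊗ m y y'`. -/
structure TwoAssocBialgData.IsBialgebra {K : Type u} {H : Type v} [Field K] [AddCommGroup H]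
    [Module K H] (B : TwoAssocBialgData K H) : Prop extends B.toTwoAssocData.IsAlgebra where
  coassoc : ∀ x, TensorProduct.assoc K H H H (B.comul.rTensor H (B.comul x)) =
    B.comul.lTensor H (B.comul x)
  counit_comul : ∀ x, TensorProduct.lid K H (B.counit.rTensor H (B.comul x)) = x
  comul_counit : ∀ x, TensorProduct.rid K H (B.counit.lTensor H (B.comul x)) = x
  comul_one : B.comul B.one = B.one ⊗ₜ[K] B.one
  counit_one : B.counit B.one = 1
  comul_star : ∀ x y, B.comul (B.star x y) =
    TensorProduct.map₂ B.star B.star (B.comul x) (B.comul y)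
  counit_star : ∀ x y, B.counit (B.star x y) = B.counit x * B.counit y
  comul_dot : ∀ x y, B.comul (B.dot x y) =
    TensorProduct.map₂ B.dot B.dot (x ⊗ₜ[K] B.one) (B.comul y) +
    TensorProduct.map₂ B.dot B.dot (B.comul x) (B.one ⊗ₜ[K] y) - x ⊗ₜ[K] y

/-- Homomorphisms of 2-associative bialgebras. -/
structure TwoAssocBialgData.IsHom {K : Type u} {H : Type v} {L : Type w} [Field K]
    [AddCommGroup H] [Module K H] [AddCommGroup L] [Module K L]
    (B : TwoAssocBialgData K H) (C : TwoAssocBialgData K L) (f : H →ₗ[K] L) : Prop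
    extends B.toTwoAssocData.IsHom C.toTwoAssocData f where
  map_comul : ∀ x, C.comul (f x) = TensorProduct.map f f (B.comul x)
  map_counit : ∀ x, C.counit (f x) = B.counit x

/-- The space of primitive elements. -/
def TwoAssocBialgData.prim {K : Type u} {H : Type v} [Field K] [AddCommGroup H] [Module K H]
    (B : TwoAssocBialgData K H) : Submodule K H where
  carrier := {x | B.comul x = x ⊗ₜ[K] B.one + B.one ⊗ₜ[K] x}
  zero_mem' := by simp
  add_mem' := by
    intro a b ha hb
    simp only [Set.mem_ofPred_eq] at *
    rw [map_add, ha, hb, TensorProduct.add_tmul, TensorProduct.tmul_add]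
    abel
  smul_mem' := by
    intro c a ha
    simp only [Set.mem_ofPred_eq] at *
    rw [map_smul, ha, smul_add, TensorProduct.smul_tmul', TensorProduct.tmul_smul]

/-! ## The free unital 2-associative algebra `2as(V)` and its coproduct -/

namespace FreeTwoAssoc

/-- Formal expressions in the vectors of `V` and the operations of 2-associative algebras. -/
inductive Pre (K : Type u) (V : Type v) : Type max u v
  | of (x : V) : Pre K V
  | zero : Pre K V
  | add (a b : Pre K V) : Pre K V
  | smul (c : K) (a : Pre K V) : Pre K V
  | one : Pre K V
  | star (a b : Pre K V) : Pre K V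
  | dot (a b : Pre K V) : Pre K V

open Pre

/-- The congruence generated by the axioms of vector spaces, the linearity of `of`, and the
axioms of unital 2-associative algebras. -/
inductive Rel (K : Type u) (V : Type v) [Field K] [AddCommGroup V] [Module K V] :
    Pre K V → Pre K V → Prop
  | refl (a) : Rel K V a a
  | symm {a b} : Rel K V a b → Rel K V b a
  | trans {a b c} : Rel K V a b → Rel K V b c → Rel K V a c
  | add_congr {a a' b b'} : Rel K V a a' → Rel K V b b' → Rel K V (add a b) (add a' b')
  | smul_congr (c) {a a'} : Rel K V a a' → Rel K V (smul c a) (smul c a')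
  | star_congr {a a' b b'} : Rel K V a a' → Rel K V b b' → Rel K V (star a b) (star a' b')
  | dot_congr {a a' b b'} : Rel K V a a' → Rel K V b b' → Rel K V (dot a b) (dot a' b')
  | add_assoc (a b c) : Rel K V (add (add a b) c) (add a (add b c))
  | add_comm (a b) : Rel K V (add a b) (add b a)
  | zero_add (a) : Rel K V (add zero a) a
  | neg_add (a) : Rel K V (add (smul (-1) a) a) zero
  | smul_add (c a b) : Rel K V (smul c (add a b)) (add (smul c a) (smul c b))
  | add_smul (c d a) : Rel K V (smul (c + d) a) (add (smul c a) (smul d a))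
  | mul_smul (c d a) : Rel K V (smul (c * d) a) (smul c (smul d a))
  | one_smul (a) : Rel K V (smul 1 a) a
  | of_add (x y) : Rel K V (of (x + y)) (add (of x) (of y))
  | of_smul (c x) : Rel K V (of (c • x)) (smul c (of x))
  | add_star (a b c) : Rel K V (star (add a b) c) (add (star a c) (star b c))
  | smul_star (r a b) : Rel K V (star (smul r a) b) (smul r (star a b))
  | star_add (a b c) : Rel K V (star a (add b c)) (add (star a b) (star a c))
  | star_smul (r a b) : Rel K V (star a (smul r b)) (smul r (star a b))
  | add_dot (a b c) : Rel K V (dot (add a b) c) (add (dot a c) (dot b c))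
  | smul_dot (r a b) : Rel K V (dot (smul r a) b) (smul r (dot a b))
  | dot_add (a b c) : Rel K V (dot a (add b c)) (add (dot a b) (dot a c))
  | dot_smul (r a b) : Rel K V (dot a (smul r b)) (smul r (dot a b))
  | star_assoc (a b c) : Rel K V (star (star a b) c) (star a (star b c))
  | one_star (a) : Rel K V (star one a) a
  | star_one (a) : Rel K V (star a one) a
  | dot_assoc (a b c) : Rel K V (dot (dot a b) c) (dot a (dot b c))
  | one_dot (a) : Rel K V (dot one a) a
  | dot_one (a) : Rel K V (dot a one) a

instance setoid (K : Type u) (V : Type v) [Field K] [AddCommGroup V] [Module K V] :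
    Setoid (Pre K V) := ⟨Rel K V, Rel.refl, Rel.symm, Rel.trans⟩

end FreeTwoAssoc

/-- The free unital 2-associative algebra `2as(V)`. -/
def FreeTwoAssoc (K : Type u) (V : Type v) [Field K] [AddCommGroup V] [Module K V] : Type max u v :=
  Quotient (FreeTwoAssoc.setoid K V)

namespace FreeTwoAssoc

section

variable (K : Type u) (V : Type v) [Field K] [AddCommGroup V] [Module K V]

/-- The class of an expression. -/
def mk (a : Pre K V) : FreeTwoAssoc K V := Quotient.mk _ a

instance : Zero (FreeTwoAssoc K V) := ⟨mk K V Pre.zero⟩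

instance : Add (FreeTwoAssoc K V) :=
  ⟨Quotient.map₂ Pre.add fun _ _ h _ _ h' => Rel.add_congr h h'⟩

instance : Neg (FreeTwoAssoc K V) := ⟨Quotient.map (Pre.smul (-1)) fun _ _ h => Rel.smul_congr _ h⟩

instance : AddCommGroup (FreeTwoAssoc K V) where
  add_assoc := by rintro ⟨a⟩ ⟨b⟩ ⟨c⟩; exact Quotient.sound (Rel.add_assoc a b c)
  add_comm := by rintro ⟨a⟩ ⟨b⟩; exact Quotient.sound (Rel.add_comm a b)
  zero_add := by rintro ⟨a⟩; exact Quotient.sound (Rel.zero_add a)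
  add_zero := by
    rintro ⟨a⟩; exact Quotient.sound ((Rel.add_comm _ _).trans (Rel.zero_add a))
  neg_add_cancel := by rintro ⟨a⟩; exact Quotient.sound (Rel.neg_add a)
  nsmul := nsmulRec
  zsmul := zsmulRec

instance : SMul K (FreeTwoAssoc K V) where
  smul c := Quotient.map (Pre.smul c) fun _ _ h => Rel.smul_congr _ h

instance : Module K (FreeTwoAssoc K V) :=
  Module.ofMinimalAxioms
    (by rintro c ⟨a⟩ ⟨b⟩; exact Quotient.sound (Rel.smul_add c a b))
    (by rintro c d ⟨a⟩; exact Quotient.sound (Rel.add_smul c d a))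
    (by rintro c d ⟨a⟩; exact Quotient.sound (Rel.mul_smul c d a))
    (by rintro ⟨a⟩; exact Quotient.sound (Rel.one_smul a))

/-- The canonical map `V → 2as(V)`. -/
def ι : V →ₗ[K] FreeTwoAssoc K V where
  toFun x := mk K V (Pre.of x)
  map_add' x y := Quotient.sound (Rel.of_add x y)
  map_smul' c x := Quotient.sound (Rel.of_smul c x)

/-- The 2-associative structure of `2as(V)`. -/
def data : TwoAssocData K (FreeTwoAssoc K V) where
  one := mk K V Pre.one
  star := LinearMap.mk₂ K (Quotient.map₂ Pre.star fun _ _ h _ _ h' => Rel.star_congr h h')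
    (by rintro ⟨a⟩ ⟨b⟩ ⟨c⟩; exact Quotient.sound (Rel.add_star a b c))
    (by rintro r ⟨a⟩ ⟨b⟩; exact Quotient.sound (Rel.smul_star r a b))
    (by rintro ⟨a⟩ ⟨b⟩ ⟨c⟩; exact Quotient.sound (Rel.star_add a b c))
    (by rintro r ⟨a⟩ ⟨b⟩; exact Quotient.sound (Rel.star_smul r a b))
  dot := LinearMap.mk₂ K (Quotient.map₂ Pre.dot fun _ _ h _ _ h' => Rel.dot_congr h h')
    (by rintro ⟨a⟩ ⟨b⟩ ⟨c⟩; exact Quotient.sound (Rel.add_dot a b c))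
    (by rintro r ⟨a⟩ ⟨b⟩; exact Quotient.sound (Rel.smul_dot r a b))
    (by rintro ⟨a⟩ ⟨b⟩ ⟨c⟩; exact Quotient.sound (Rel.dot_add a b c))
    (by rintro r ⟨a⟩ ⟨b⟩; exact Quotient.sound (Rel.dot_smul r a b))

theorem data_isAlgebra : (data K V).IsAlgebra where
  star_assoc := by rintro ⟨a⟩ ⟨b⟩ ⟨c⟩; exact Quotient.sound (Rel.star_assoc a b c)
  one_star := by rintro ⟨a⟩; exact Quotient.sound (Rel.one_star a)
  star_one := by rintro ⟨a⟩; exact Quotient.sound (Rel.star_one a)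
  dot_assoc := by rintro ⟨a⟩ ⟨b⟩ ⟨c⟩; exact Quotient.sound (Rel.dot_assoc a b c)
  one_dot := by rintro ⟨a⟩; exact Quotient.sound (Rel.one_dot a)
  dot_one := by rintro ⟨a⟩; exact Quotient.sound (Rel.dot_one a)

variable {K V}

/-- The value of an expression in a 2-associative algebra, given the values of the vectors. -/
def Pre.eval {A : Type w} [AddCommGroup A] [Module K A] (O : TwoAssocData K A) (f : V →ₗ[K] A) :
    Pre K V → A
  | .of x => f x
  | .zero => 0
  | .add a b => Pre.eval O f a + Pre.eval O f b
  | .smul c a => c • Pre.eval O f a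
  | .one => O.one
  | .star a b => O.star (Pre.eval O f a) (Pre.eval O f b)
  | .dot a b => O.dot (Pre.eval O f a) (Pre.eval O f b)

theorem Rel.eval_eq {A : Type w} [AddCommGroup A] [Module K A] {O : TwoAssocData K A}
    (hO : O.IsAlgebra) (f : V →ₗ[K] A) {a b : Pre K V} (h : Rel K V a b) :
    Pre.eval O f a = Pre.eval O f b := by
  induction h with
  | refl => rfl
  | symm _ ih => exact ih.symm
  | trans _ _ ih ih' => exact ih.trans ih'
  | add_assoc => exact _root_.add_assoc _ _ _
  | add_comm => exact _root_.add_comm _ _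
  | add_smul => exact _root_.add_smul _ _ _
  | mul_smul => exact (smul_smul _ _ _).symm
  | _ =>
    simp_all [Pre.eval, hO.star_assoc, hO.one_star, hO.star_one, hO.dot_assoc, hO.one_dot,
      hO.dot_one]

/-- `2as(V)` is free: every linear map from `V` to a unital 2-associative algebra extends uniquely
to a homomorphism. -/
theorem existsUnique_lift {A : Type w} [AddCommGroup A] [Module K A] (O : TwoAssocData K A)
    (hO : O.IsAlgebra) (f : V →ₗ[K] A) :
    ∃! F : FreeTwoAssoc K V →ₗ[K] A, (data K V).IsHom O F ∧ ∀ x, F (ι K V x) = f x := by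
  refine ⟨{ toFun := Quotient.lift (Pre.eval O f) fun _ _ h => Rel.eval_eq hO f h
            map_add' := by rintro ⟨a⟩ ⟨b⟩; rfl
            map_smul' := by rintro c ⟨a⟩; rfl }, ⟨⟨rfl, ?_, ?_⟩, fun _ => rfl⟩, ?_⟩
  · rintro ⟨a⟩ ⟨b⟩; rfl
  · rintro ⟨a⟩ ⟨b⟩; rfl
  · rintro G ⟨hG, hG'⟩
    ext ⟨a⟩
    change G (mk K V a) = Pre.eval O f a
    induction a with
    | of x => exact hG' x
    | zero => exact map_zero G
    | add a b iha ihb => exact (map_add G (mk K V a) (mk K V b)).trans (by rw [iha, ihb]; rfl)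
    | smul c a ih => exact (map_smul G c (mk K V a)).trans (by rw [ih]; rfl)
    | one => exact hG.map_one
    | star a b iha ihb => exact (hG.map_star (mk K V a) (mk K V b)).trans (by rw [iha, ihb]; rfl)
    | dot a b iha ihb => exact (hG.map_dot (mk K V a) (mk K V b)).trans (by rw [iha, ihb]; rfl)

/-- The coproduct on expressions, defined recursively by
`Δ(1) = 1 ⊗ 1`, `Δ(v) = v ⊗ 1 + 1 ⊗ v`, `Δ(x * y) = Δ(x) * Δ(y)` and
`Δ(x · y) = (x ⊗ 1) · Δ(y) + Δ(x) · (1 ⊗ y) - x ⊗ y`. -/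
def Pre.comul : Pre K V → FreeTwoAssoc K V ⊗[K] FreeTwoAssoc K V
  | .of x => ι K V x ⊗ₜ[K] (data K V).one + (data K V).one ⊗ₜ[K] ι K V x
  | .zero => 0
  | .add a b => Pre.comul a + Pre.comul b
  | .smul c a => c • Pre.comul a
  | .one => (data K V).one ⊗ₜ[K] (data K V).one
  | .star a b => TensorProduct.map₂ (data K V).star (data K V).star (Pre.comul a) (Pre.comul b)
  | .dot a b =>
      TensorProduct.map₂ (data K V).dot (data K V).dot
        (mk K V a ⊗ₜ[K] (data K V).one) (Pre.comul b) +
      TensorProduct.map₂ (data K V).dot (data K V).dot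
        (Pre.comul a) ((data K V).one ⊗ₜ[K] mk K V b) -
      mk K V a ⊗ₜ[K] mk K V b

theorem map₂_assoc {A : Type w} [AddCommGroup A] [Module K A] (m : A →ₗ[K] A →ₗ[K] A)
    (hm : ∀ a b c, m (m a b) c = m a (m b c)) (x y z : A ⊗[K] A) :
    TensorProduct.map₂ m m (TensorProduct.map₂ m m x y) z =
      TensorProduct.map₂ m m x (TensorProduct.map₂ m m y z) := by
  induction x with
  | zero => simp
  | add x x' hx hx' => simp only [map_add, LinearMap.add_apply, hx, hx']
  | tmul a a' =>
    induction y with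
    | zero => simp
    | add y y' hy hy' => simp only [map_add, LinearMap.add_apply, hy, hy']
    | tmul b b' =>
      induction z with
      | zero => simp
      | add z z' hz hz' => simp only [map_add, hz, hz']
      | tmul c c' => simp [TensorProduct.map₂_apply_tmul, hm]

theorem map₂_one {A : Type w} [AddCommGroup A] [Module K A] (m : A →ₗ[K] A →ₗ[K] A) (e : A)
    (he : ∀ a, m a e = a) (x : A ⊗[K] A) : TensorProduct.map₂ m m x (e ⊗ₜ[K] e) = x := by
  induction x with
  | zero => simp
  | add x x' hx hx' => simp only [map_add, LinearMap.add_apply, hx, hx']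
  | tmul a a' => simp [TensorProduct.map₂_apply_tmul, he]

theorem one_map₂ {A : Type w} [AddCommGroup A] [Module K A] (m : A →ₗ[K] A →ₗ[K] A) (e : A)
    (he : ∀ a, m e a = a) (x : A ⊗[K] A) : TensorProduct.map₂ m m (e ⊗ₜ[K] e) x = x := by
  induction x with
  | zero => simp
  | add x x' hx hx' => simp only [map_add, hx, hx']
  | tmul a a' => simp [TensorProduct.map₂_apply_tmul, he]

theorem mk_add (a b : Pre K V) : mk K V (.add a b) = mk K V a + mk K V b := rfl
theorem mk_smul (c : K) (a : Pre K V) : mk K V (.smul c a) = c • mk K V a := rfl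
theorem mk_zero : mk K V .zero = 0 := rfl
theorem mk_one : mk K V .one = (data K V).one := rfl
theorem mk_star (a b : Pre K V) :
    mk K V (.star a b) = (data K V).star (mk K V a) (mk K V b) := rfl
theorem mk_dot (a b : Pre K V) : mk K V (.dot a b) = (data K V).dot (mk K V a) (mk K V b) := rfl

theorem Rel.comul_eq {a b : Pre K V} (h : Rel K V a b) : Pre.comul a = Pre.comul b := by
  have hO := data_isAlgebra K V
  have ht (m : FreeTwoAssoc K V →ₗ[K] FreeTwoAssoc K V →ₗ[K] FreeTwoAssoc K V)
      (x y x' y' : FreeTwoAssoc K V) : TensorProduct.map₂ m m (x ⊗ₜ[K] y) (x' ⊗ₜ[K] y') =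
      m x x' ⊗ₜ[K] m y y' := rfl
  induction h with
  | refl => rfl
  | symm _ ih => exact ih.symm
  | trans _ _ ih ih' => exact ih.trans ih'
  | dot_congr h h' ih ih' =>
    have e : mk K V _ = mk K V _ := Quotient.sound h
    have e' : mk K V _ = mk K V _ := Quotient.sound h'
    simp only [Pre.comul, ih, ih', e, e']
  | add_congr _ _ ih ih' => simp only [Pre.comul, ih, ih']
  | star_congr _ _ ih ih' => simp only [Pre.comul, ih, ih']
  | smul_congr _ _ ih => simp only [Pre.comul, ih]
  | add_assoc => simp only [Pre.comul, _root_.add_assoc]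
  | add_comm a b => exact _root_.add_comm (Pre.comul a) (Pre.comul b)
  | zero_add => simp only [Pre.comul, _root_.zero_add]
  | neg_add => simp [Pre.comul]
  | smul_add => simp only [Pre.comul, _root_.smul_add]
  | add_smul => simp only [Pre.comul, _root_.add_smul]
  | mul_smul => simp only [Pre.comul, smul_smul]
  | one_smul => simp only [Pre.comul, _root_.one_smul]
  | of_add =>
    simp only [Pre.comul, map_add, TensorProduct.add_tmul, TensorProduct.tmul_add]; abel
  | of_smul =>
    simp only [Pre.comul, map_smul, TensorProduct.smul_tmul', TensorProduct.tmul_smul,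
      _root_.smul_add]
  | add_star => simp only [Pre.comul, map_add, LinearMap.add_apply]
  | smul_star => simp only [Pre.comul, map_smul, LinearMap.smul_apply]
  | star_add => simp only [Pre.comul, map_add]
  | star_smul => simp only [Pre.comul, map_smul]
  | add_dot =>
    simp only [Pre.comul, map_add, LinearMap.add_apply, mk_add, TensorProduct.add_tmul]; abel
  | smul_dot =>
    simp only [Pre.comul, map_smul, LinearMap.smul_apply, mk_smul, ← TensorProduct.smul_tmul',
      _root_.smul_add, smul_sub]
  | dot_add =>
    simp only [Pre.comul, map_add, mk_add, TensorProduct.tmul_add]; abel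
  | dot_smul =>
    simp only [Pre.comul, map_smul, mk_smul, TensorProduct.tmul_smul, _root_.smul_add, smul_sub]
  | star_assoc => simp only [Pre.comul, map₂_assoc _ hO.star_assoc]
  | one_star => simp only [Pre.comul, one_map₂ _ _ hO.one_star]
  | star_one => simp only [Pre.comul, map₂_one _ _ hO.star_one]
  | dot_assoc =>
    simp only [Pre.comul, map_add, map_sub, LinearMap.add_apply, LinearMap.sub_apply,
      ← map₂_assoc _ hO.dot_assoc, ht, mk_dot, hO.one_dot, hO.dot_one]
    simp only [map₂_assoc _ hO.dot_assoc, ht, hO.one_dot]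
    abel
  | one_dot =>
    simp only [Pre.comul, one_map₂ _ _ hO.one_dot, mk_one]
    abel
  | dot_one =>
    simp only [Pre.comul, map₂_one _ _ hO.dot_one, mk_one]
    abel

/-- The counit on expressions: it vanishes on `V` and is multiplicative for both products. -/
def Pre.counit : Pre K V → K :=
  Pre.eval ⟨1, LinearMap.mul K K, LinearMap.mul K K⟩ 0

theorem Rel.counit_eq {a b : Pre K V} (h : Rel K V a b) : Pre.counit a = Pre.counit b :=
  Rel.eval_eq (by constructor <;> intros <;> simp [mul_assoc]) _ h

variable (K V)

/-- The bialgebra operations of `2as(V)`. -/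
def bialgData : TwoAssocBialgData K (FreeTwoAssoc K V) where
  __ := data K V
  comul :=
    { toFun := Quotient.lift Pre.comul fun _ _ h => Rel.comul_eq h
      map_add' := by rintro ⟨a⟩ ⟨b⟩; rfl
      map_smul' := by rintro c ⟨a⟩; rfl }
  counit :=
    { toFun := Quotient.lift Pre.counit fun _ _ h => Rel.counit_eq h
      map_add' := by rintro ⟨a⟩ ⟨b⟩; rfl
      map_smul' := by rintro c ⟨a⟩; rfl }

theorem ι_mem_prim (x : V) : ι K V x ∈ (bialgData K V).prim := rfl

end

end FreeTwoAssoc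

/-! ## Cutting a pair of words into blocks -/

/-- All ways of cutting the pair of words `(u₁…u_p, v₁…v_q)` into `k` consecutive blocks
`(u₁…u_{i₁}, v₁…v_{j₁}), (u_{i₁+1}…u_{i₁+i₂}, v_{j₁+1}…v_{j₁+j₂}), …` with `i₁ + ⋯ + i_k = p`
and `j₁ + ⋯ + j_k = q`. Blocks with `i_s = j_s = 0` are left out: the operation `M₀₀` that would
be applied to them is zero. -/
def blockCuts {X : Type u} : ℕ → List X → List X → List (List (List X × List X))
  | 0, u, v => if u.length + v.length = 0 then [[]] else []
  | k + 1, u, v =>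
    (List.range (u.length + 1)).flatMap fun i => (List.range (v.length + 1)).flatMap fun j =>
      if i + j = 0 then []
      else (blockCuts k (u.drop i) (v.drop j)).map fun c => (u.take i, v.take j) :: c

/-- The cuts of `(u, v)` into any number of blocks. -/
def allBlockCuts {X : Type u} (u v : List X) : List (List (List X × List X)) :=
  (List.range (u.length + v.length + 1)).flatMap fun k => blockCuts k u v

/-- The word `M_{i₁j₁}(…) M_{i₂j₂}(…) ⋯ M_{i_kj_k}(…)` obtained from a cut by applying the
operations `M` to its blocks. -/
def blockWord {X : Type u} {Y : Type v} (M : List X → List X → Y) (c : List (List X × List X)) :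
    List Y :=
  c.map fun b => M b.1 b.2

theorem mem_blockCuts {X : Type u} (k : ℕ) (u v : List X) (c : List (List X × List X)) :
    c ∈ blockCuts k u v ↔ c.length = k ∧ (c.map Prod.fst).flatten = u ∧
      (c.map Prod.snd).flatten = v ∧ ∀ b ∈ c, b.1.length + b.2.length ≠ 0 := by
  induction k generalizing u v c with
  | zero =>
    simp only [blockCuts]
    split_ifs with h
    · have hu : u = [] := List.length_eq_zero_iff.mp (by omega)
      have hv : v = [] := List.length_eq_zero_iff.mp (by omega)
      subst hu hv
      constructor
      · intro hc; simp at hc; subst hc; simp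
      · rintro ⟨hc, -⟩; simpa using hc
    · constructor
      · intro hc; simp at hc
      · rintro ⟨hc, h1, h2, -⟩
        have : c = [] := List.length_eq_zero_iff.mp hc
        subst this
        simp at h1 h2
        subst h1 h2
        simp at h
  | succ k ih =>
    simp only [blockCuts, List.mem_flatMap, List.mem_range]
    constructor
    · rintro ⟨i, hi, j, hj, hc⟩
      split_ifs at hc with h
      · simp at hc
      · obtain ⟨d, hd, rfl⟩ := List.mem_map.mp hc
        obtain ⟨h1, h2, h3, h4⟩ := (ih _ _ _).mp hd
        refine ⟨by simp [h1], by simp [h2], by simp [h3], ?_⟩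
        intro b hb
        rcases List.mem_cons.mp hb with rfl | hb
        · simp only [List.length_take]; omega
        · exact h4 b hb
    · rintro ⟨h1, h2, h3, h4⟩
      cases c with
      | nil => simp at h1
      | cons b d =>
        simp only [List.map_cons, List.flatten_cons] at h2 h3
        subst h2 h3
        have hb := h4 b (by simp)
        refine ⟨b.1.length, by simp, b.2.length, by simp, ?_⟩
        rw [if_neg hb]
        refine List.mem_map.mpr ⟨d, (ih _ _ _).mpr ⟨by simpa using h1, by simp, by simp, ?_⟩, by simp⟩
        intro x hx
        exact h4 x (by simp [hx])

theorem blockCuts_map {X : Type u} {Y : Type v} (f : X → Y) (k : ℕ) (u v : List X) :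
    blockCuts k (u.map f) (v.map f) =
      (blockCuts k u v).map (List.map (Prod.map (List.map f) (List.map f))) := by
  induction k generalizing u v with
  | zero => simp only [blockCuts, List.length_map]; split_ifs <;> simp
  | succ k ih =>
    simp only [blockCuts, List.length_map, List.map_flatMap]
    congr 1; funext i; congr 1; funext j
    split_ifs with h
    · simp
    · rw [← List.map_drop, ← List.map_drop, ih, ← List.map_take, ← List.map_take]
      simp [Function.comp_def]

theorem allBlockCuts_map {X : Type u} {Y : Type v} (f : X → Y) (u v : List X) :
    allBlockCuts (u.map f) (v.map f) =
      (allBlockCuts u v).map (List.map (Prod.map (List.map f) (List.map f))) := by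
  simp only [allBlockCuts, List.length_map, List.map_flatMap, blockCuts_map]

theorem length_lt_of_mem_allBlockCuts {X : Type u} {u v : List X} {c : List (List X × List X)}
    (hc : c ∈ allBlockCuts u v) (h2 : 2 ≤ c.length) {b : List X × List X} (hb : b ∈ c) :
    b.1.length + b.2.length < u.length + v.length := by
  obtain ⟨k, -, hk⟩ := List.mem_flatMap.mp hc
  obtain ⟨-, rfl, rfl, hne⟩ := (mem_blockCuts _ _ _ _).mp hk
  obtain ⟨s, t, rfl⟩ := List.append_of_mem hb
  have key : ∃ x ∈ s ++ t, x ∈ s ++ b :: t := by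
    cases s with
    | cons x s => exact ⟨x, by simp, by simp⟩
    | nil =>
      cases t with
      | cons x t => exact ⟨x, by simp, by simp⟩
      | nil => simp at h2
  obtain ⟨x, hx, hx'⟩ := key
  have := hne x hx'
  have h1 : x.1.length ≤ ((s ++ t).map fun y => y.1.length).sum :=
    List.single_le_sum (by simp) _ (List.mem_map.mpr ⟨x, hx, rfl⟩)
  have h2 : x.2.length ≤ ((s ++ t).map fun y => y.2.length).sum :=
    List.single_le_sum (by simp) _ (List.mem_map.mpr ⟨x, hx, rfl⟩)
  simp only [List.map_append, List.sum_append] at h1 h2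
  simp only [List.map_append, List.map_cons, List.flatten_append, List.flatten_cons,
    List.length_append, List.length_flatten, List.map_map, Function.comp_def]
  omega

/-! ## `B∞`-algebras -/

/-- A `B∞`-algebra structure on the vector space `R`. The value of the operation
`M_pq : R^{⊗p} ⊗ R^{⊗q} → R` at `u₁ ⊗ ⋯ ⊗ u_p ⊗ v₁ ⊗ ⋯ ⊗ v_q` is `M u v` for the words
`u = [u₁, …, u_p]` and `v = [v₁, …, v_q]`; the first four axioms say that each `M_pq` is
multilinear. -/
structure BInfAlgebra (K : Type u) (R : Type v) [Field K] [AddCommGroup R] [Module K R] where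
  M : List R → List R → R
  M_add_left : ∀ l m a b v, M (l ++ (a + b) :: m) v = M (l ++ a :: m) v + M (l ++ b :: m) v
  M_smul_left : ∀ l m (c : K) a v, M (l ++ (c • a) :: m) v = c • M (l ++ a :: m) v
  M_add_right : ∀ l m a b u, M u (l ++ (a + b) :: m) = M u (l ++ a :: m) + M u (l ++ b :: m)
  M_smul_right : ∀ l m (c : K) a u, M u (l ++ (c • a) :: m) = c • M u (l ++ a :: m)
  M_nil_nil : M [] [] = 0
  M_singleton_nil : ∀ a, M [a] [] = a
  M_nil_singleton : ∀ a, M [] [a] = a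
  M_nil_right : ∀ u, 2 ≤ u.length → M u [] = 0
  M_nil_left : ∀ v, 2 ≤ v.length → M [] v = 0
  /-- The relation `R_ijk` on words of lengths `i, j, k ≥ 1`. -/
  rel : ∀ u v w, u ≠ [] → v ≠ [] → w ≠ [] →
    ((allBlockCuts u v).map fun c => M (blockWord M c) w).sum =
      ((allBlockCuts v w).map fun c => M u (blockWord M c)).sum

/-- Homomorphisms of `B∞`-algebras. -/
def BInfAlgebra.IsHom {K : Type u} {R : Type v} {S : Type w} [Field K]
    [AddCommGroup R] [Module K R] [AddCommGroup S] [Module K S]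
    (P : BInfAlgebra K R) (Q : BInfAlgebra K S) (f : R →ₗ[K] S) : Prop :=
  ∀ u v, f (P.M u v) = Q.M (u.map f) (v.map f)

/-! ## The free `B∞`-algebra -/

namespace FreeBInf

/-- Formal expressions in the vectors of `V` and the operations of `B∞`-algebras. -/
inductive Pre (K : Type u) (V : Type v) : Type max u v
  | of (x : V) : Pre K V
  | zero : Pre K V
  | add (a b : Pre K V) : Pre K V
  | smul (c : K) (a : Pre K V) : Pre K V
  | op (p q : ℕ) (a : Fin p → Pre K V) (b : Fin q → Pre K V) : Pre K V

/-- The formal operation `M_pq` on words of lengths `p` and `q`. -/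
def Pre.M {K : Type u} {V : Type v} (a b : List (Pre K V)) : Pre K V :=
  Pre.op a.length b.length a.get b.get

/-- The formal sum of a list of expressions. -/
def Pre.sum {K : Type u} {V : Type v} (l : List (Pre K V)) : Pre K V :=
  l.foldr Pre.add Pre.zero

open Pre

/-- The congruence generated by the axioms of vector spaces, the linearity of `of`, and the
axioms of `B∞`-algebras. -/
inductive Rel (K : Type u) (V : Type v) [Field K] [AddCommGroup V] [Module K V] :
    Pre K V → Pre K V → Prop
  | refl (a) : Rel K V a a
  | symm {a b} : Rel K V a b → Rel K V b a
  | trans {a b c} : Rel K V a b → Rel K V b c → Rel K V a c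
  | add_congr {a a' b b'} : Rel K V a a' → Rel K V b b' → Rel K V (add a b) (add a' b')
  | smul_congr (c) {a a'} : Rel K V a a' → Rel K V (smul c a) (smul c a')
  | M_congr_left (l m) {a a'} (v) :
      Rel K V a a' → Rel K V (M (l ++ a :: m) v) (M (l ++ a' :: m) v)
  | M_congr_right (l m) {a a'} (u) :
      Rel K V a a' → Rel K V (M u (l ++ a :: m)) (M u (l ++ a' :: m))
  | add_assoc (a b c) : Rel K V (add (add a b) c) (add a (add b c))
  | add_comm (a b) : Rel K V (add a b) (add b a)
  | zero_add (a) : Rel K V (add zero a) a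
  | neg_add (a) : Rel K V (add (smul (-1) a) a) zero
  | smul_add (c a b) : Rel K V (smul c (add a b)) (add (smul c a) (smul c b))
  | add_smul (c d a) : Rel K V (smul (c + d) a) (add (smul c a) (smul d a))
  | mul_smul (c d a) : Rel K V (smul (c * d) a) (smul c (smul d a))
  | one_smul (a) : Rel K V (smul 1 a) a
  | of_add (x y) : Rel K V (of (x + y)) (add (of x) (of y))
  | of_smul (c x) : Rel K V (of (c • x)) (smul c (of x))
  | M_add_left (l m a b v) :
      Rel K V (M (l ++ add a b :: m) v) (add (M (l ++ a :: m) v) (M (l ++ b :: m) v))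
  | M_smul_left (l m c a v) : Rel K V (M (l ++ smul c a :: m) v) (smul c (M (l ++ a :: m) v))
  | M_add_right (l m a b u) :
      Rel K V (M u (l ++ add a b :: m)) (add (M u (l ++ a :: m)) (M u (l ++ b :: m)))
  | M_smul_right (l m c a u) : Rel K V (M u (l ++ smul c a :: m)) (smul c (M u (l ++ a :: m)))
  | M_nil_nil : Rel K V (M [] []) zero
  | M_singleton_nil (a) : Rel K V (M [a] []) a
  | M_nil_singleton (a) : Rel K V (M [] [a]) a
  | M_nil_right (u : List (Pre K V)) : 2 ≤ u.length → Rel K V (M u []) zero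
  | M_nil_left (v : List (Pre K V)) : 2 ≤ v.length → Rel K V (M [] v) zero
  | rel (u v w : List (Pre K V)) : u ≠ [] → v ≠ [] → w ≠ [] →
      Rel K V (Pre.sum ((allBlockCuts u v).map fun c => M (blockWord M c) w))
        (Pre.sum ((allBlockCuts v w).map fun c => M u (blockWord M c)))

instance setoid (K : Type u) (V : Type v) [Field K] [AddCommGroup V] [Module K V] :
    Setoid (Pre K V) := ⟨Rel K V, Rel.refl, Rel.symm, Rel.trans⟩

end FreeBInf

/-- The free `B∞`-algebra `B∞(V)`. -/
def FreeBInf (K : Type u) (V : Type v) [Field K] [AddCommGroup V] [Module K V] : Type max u v :=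
  Quotient (FreeBInf.setoid K V)

namespace FreeBInf

section

variable (K : Type u) (V : Type v) [Field K] [AddCommGroup V] [Module K V]

/-- The class of an expression. -/
def mk (a : Pre K V) : FreeBInf K V := Quotient.mk _ a

instance : Zero (FreeBInf K V) := ⟨mk K V Pre.zero⟩

instance : Add (FreeBInf K V) :=
  ⟨Quotient.map₂ Pre.add fun _ _ h _ _ h' => Rel.add_congr h h'⟩

instance : Neg (FreeBInf K V) := ⟨Quotient.map (Pre.smul (-1)) fun _ _ h => Rel.smul_congr _ h⟩

instance : AddCommGroup (FreeBInf K V) where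
  add_assoc := by rintro ⟨a⟩ ⟨b⟩ ⟨c⟩; exact Quotient.sound (Rel.add_assoc a b c)
  add_comm := by rintro ⟨a⟩ ⟨b⟩; exact Quotient.sound (Rel.add_comm a b)
  zero_add := by rintro ⟨a⟩; exact Quotient.sound (Rel.zero_add a)
  add_zero := by
    rintro ⟨a⟩; exact Quotient.sound ((Rel.add_comm _ _).trans (Rel.zero_add a))
  neg_add_cancel := by rintro ⟨a⟩; exact Quotient.sound (Rel.neg_add a)
  nsmul := nsmulRec
  zsmul := zsmulRec

instance : SMul K (FreeBInf K V) where
  smul c := Quotient.map (Pre.smul c) fun _ _ h => Rel.smul_congr _ h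

instance : Module K (FreeBInf K V) :=
  Module.ofMinimalAxioms
    (by rintro c ⟨a⟩ ⟨b⟩; exact Quotient.sound (Rel.smul_add c a b))
    (by rintro c d ⟨a⟩; exact Quotient.sound (Rel.add_smul c d a))
    (by rintro c d ⟨a⟩; exact Quotient.sound (Rel.mul_smul c d a))
    (by rintro ⟨a⟩; exact Quotient.sound (Rel.one_smul a))

/-- The canonical map `V → B∞(V)`. -/
def ι : V →ₗ[K] FreeBInf K V where
  toFun x := mk K V (Pre.of x)
  map_add' x y := Quotient.sound (Rel.of_add x y)
  map_smul' c x := Quotient.sound (Rel.of_smul c x)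

/-- A representative of a class. -/
def rep (a : FreeBInf K V) : Pre K V := Quotient.out a

theorem mk_rep (a : FreeBInf K V) : mk K V (rep K V a) = a := Quotient.out_eq a

/-- The operations of `B∞(V)`, computed on representatives. -/
def M (u v : List (FreeBInf K V)) : FreeBInf K V :=
  mk K V (Pre.M (u.map (rep K V)) (v.map (rep K V)))

theorem M_congr {u u' v v' : List (Pre K V)} (hu : List.Forall₂ (Rel K V) u u')
    (hv : List.Forall₂ (Rel K V) v v') : Rel K V (Pre.M u v) (Pre.M u' v') := by
  have h1 : ∀ l : List (Pre K V), Rel K V (Pre.M (l ++ u) v) (Pre.M (l ++ u') v) := by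
    clear hv
    induction hu with
    | nil => exact fun l => Rel.refl _
    | @cons a b m m' hab hm ih =>
      intro l
      have := ih (l ++ [b])
      refine (Rel.M_congr_left l m v hab).trans ?_
      simpa using this
  have h2 : ∀ l : List (Pre K V), Rel K V (Pre.M u' (l ++ v)) (Pre.M u' (l ++ v')) := by
    clear h1 hu
    induction hv with
    | nil => exact fun l => Rel.refl _
    | @cons a b m m' hab hm ih =>
      intro l
      have := ih (l ++ [b])
      refine (Rel.M_congr_right l m u' hab).trans ?_
      simpa using this
  exact (h1 []).trans (h2 [])

theorem M_mk (u v : List (Pre K V)) :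
    M K V (u.map (mk K V)) (v.map (mk K V)) = mk K V (Pre.M u v) := by
  have h : ∀ u : List (Pre K V),
      List.Forall₂ (Rel K V) ((u.map (mk K V)).map (rep K V)) u := by
    intro u
    induction u with
    | nil => exact List.Forall₂.nil
    | cons a u ih => exact List.Forall₂.cons (Quotient.mk_out (s := setoid K V) a) ih
  exact Quotient.sound (M_congr K V (h u) (h v))

theorem exists_map_mk (u : List (FreeBInf K V)) : ∃ u' : List (Pre K V), u'.map (mk K V) = u :=
  ⟨u.map (rep K V), by simp [Function.comp_def, mk_rep]⟩

theorem mk_sum (l : List (Pre K V)) : mk K V (Pre.sum l) = (l.map (mk K V)).sum := by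
  induction l with
  | nil => rfl
  | cons a l ih => rw [List.map_cons, List.sum_cons, ← ih]; rfl

theorem map_mk_blockWord (c : List (List (Pre K V) × List (Pre K V))) :
    (blockWord Pre.M c).map (mk K V) =
      blockWord (M K V) (c.map (Prod.map (List.map (mk K V)) (List.map (mk K V)))) := by
  simp [blockWord, Function.comp_def, M_mk]

/-- The `B∞`-algebra structure of `B∞(V)`. -/
def str : BInfAlgebra K (FreeBInf K V) where
  M := M K V
  M_add_left := by
    rintro l m ⟨a⟩ ⟨b⟩ v
    obtain ⟨l, rfl⟩ := exists_map_mk K V l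
    obtain ⟨m, rfl⟩ := exists_map_mk K V m
    obtain ⟨v, rfl⟩ := exists_map_mk K V v
    have h (x : Pre K V) : l.map (mk K V) ++ mk K V x :: m.map (mk K V) =
      (l ++ x :: m).map (mk K V) := by simp
    change M K V (_ ++ mk K V (.add a b) :: _) _ =
      M K V (_ ++ mk K V a :: _) _ + M K V (_ ++ mk K V b :: _) _
    rw [h, h, h, M_mk, M_mk, M_mk]
    exact Quotient.sound (Rel.M_add_left _ _ _ _ _)
  M_smul_left := by
    rintro l m c ⟨a⟩ v
    obtain ⟨l, rfl⟩ := exists_map_mk K V l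
    obtain ⟨m, rfl⟩ := exists_map_mk K V m
    obtain ⟨v, rfl⟩ := exists_map_mk K V v
    have h (x : Pre K V) : l.map (mk K V) ++ mk K V x :: m.map (mk K V) =
      (l ++ x :: m).map (mk K V) := by simp
    change M K V (_ ++ mk K V (.smul c a) :: _) _ = c • M K V (_ ++ mk K V a :: _) _
    rw [h, h, M_mk, M_mk]
    exact Quotient.sound (Rel.M_smul_left _ _ _ _ _)
  M_add_right := by
    rintro l m ⟨a⟩ ⟨b⟩ v
    obtain ⟨l, rfl⟩ := exists_map_mk K V l
    obtain ⟨m, rfl⟩ := exists_map_mk K V m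
    obtain ⟨v, rfl⟩ := exists_map_mk K V v
    have h (x : Pre K V) : l.map (mk K V) ++ mk K V x :: m.map (mk K V) =
      (l ++ x :: m).map (mk K V) := by simp
    change M K V _ (_ ++ mk K V (.add a b) :: _) =
      M K V _ (_ ++ mk K V a :: _) + M K V _ (_ ++ mk K V b :: _)
    rw [h, h, h, M_mk, M_mk, M_mk]
    exact Quotient.sound (Rel.M_add_right _ _ _ _ _)
  M_smul_right := by
    rintro l m c ⟨a⟩ v
    obtain ⟨l, rfl⟩ := exists_map_mk K V l
    obtain ⟨m, rfl⟩ := exists_map_mk K V m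
    obtain ⟨v, rfl⟩ := exists_map_mk K V v
    have h (x : Pre K V) : l.map (mk K V) ++ mk K V x :: m.map (mk K V) =
      (l ++ x :: m).map (mk K V) := by simp
    change M K V _ (_ ++ mk K V (.smul c a) :: _) = c • M K V _ (_ ++ mk K V a :: _)
    rw [h, h, M_mk, M_mk]
    exact Quotient.sound (Rel.M_smul_right _ _ _ _ _)
  M_nil_nil := Quotient.sound Rel.M_nil_nil
  M_singleton_nil := by
    rintro ⟨a⟩
    exact (M_mk K V [a] []).trans (Quotient.sound (Rel.M_singleton_nil a))
  M_nil_singleton := by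
    rintro ⟨a⟩
    exact (M_mk K V [] [a]).trans (Quotient.sound (Rel.M_nil_singleton a))
  M_nil_right := by
    intro u hu
    exact Quotient.sound (Rel.M_nil_right _ (by simpa using hu))
  M_nil_left := by
    intro u hu
    exact Quotient.sound (Rel.M_nil_left _ (by simpa using hu))
  rel := by
    intro u v w hu hv hw
    obtain ⟨u, rfl⟩ := exists_map_mk K V u
    obtain ⟨v, rfl⟩ := exists_map_mk K V v
    obtain ⟨w, rfl⟩ := exists_map_mk K V w
    have h : mk K V _ = mk K V _ := Quotient.sound
      (Rel.rel u v w (by simpa using hu) (by simpa using hv) (by simpa using hw))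
    rw [mk_sum, mk_sum, List.map_map, List.map_map] at h
    rw [allBlockCuts_map, allBlockCuts_map, List.map_map, List.map_map]
    simpa only [Function.comp_def, ← M_mk, map_mk_blockWord] using h

variable {K V}

/-- The value of an expression in a `B∞`-algebra, given the values of the vectors. -/
def Pre.eval {R : Type w} [AddCommGroup R] [Module K R] (P : BInfAlgebra K R) (f : V →ₗ[K] R) :
    Pre K V → R
  | .of x => f x
  | .zero => 0
  | .add a b => Pre.eval P f a + Pre.eval P f b
  | .smul c a => c • Pre.eval P f a
  | .op _ _ a b => P.M (List.ofFn fun i => Pre.eval P f (a i)) (List.ofFn fun i => Pre.eval P f (b i))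

theorem Pre.eval_M {R : Type w} [AddCommGroup R] [Module K R] (P : BInfAlgebra K R)
    (f : V →ₗ[K] R) (u v : List (Pre K V)) :
    Pre.eval P f (Pre.M u v) = P.M (u.map (Pre.eval P f)) (v.map (Pre.eval P f)) := by
  have h (u : List (Pre K V)) :
      (List.ofFn fun i => Pre.eval P f (u.get i)) = u.map (Pre.eval P f) := by
    conv_rhs => rw [← List.ofFn_get u, List.map_ofFn]
    rfl
  simp only [Pre.M, Pre.eval]
  rw [h, h]

theorem Pre.eval_sum {R : Type w} [AddCommGroup R] [Module K R] (P : BInfAlgebra K R)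
    (f : V →ₗ[K] R) (l : List (Pre K V)) :
    Pre.eval P f (Pre.sum l) = (l.map (Pre.eval P f)).sum := by
  induction l with
  | nil => rfl
  | cons a l ih => rw [List.map_cons, List.sum_cons, ← ih]; rfl

theorem Rel.eval_eq {R : Type w} [AddCommGroup R] [Module K R] (P : BInfAlgebra K R)
    (f : V →ₗ[K] R) {a b : Pre K V} (h : Rel K V a b) : Pre.eval P f a = Pre.eval P f b := by
  have hw (c : List (List (Pre K V) × List (Pre K V))) :
      (blockWord Pre.M c).map (Pre.eval P f) = blockWord P.M
        (c.map (Prod.map (List.map (Pre.eval P f)) (List.map (Pre.eval P f)))) := by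
    simp [blockWord, Function.comp_def, Pre.eval_M]
  induction h with
  | refl => rfl
  | symm _ ih => exact ih.symm
  | trans _ _ ih ih' => exact ih.trans ih'
  | add_assoc => exact _root_.add_assoc _ _ _
  | add_comm => exact _root_.add_comm _ _
  | add_smul => exact _root_.add_smul _ _ _
  | mul_smul => exact (smul_smul _ _ _).symm
  | M_nil_right u hu => simpa [Pre.eval_M, Pre.eval] using P.M_nil_right _ (by simpa using hu)
  | M_nil_left u hu => simpa [Pre.eval_M, Pre.eval] using P.M_nil_left _ (by simpa using hu)
  | rel u v w hu hv hw' =>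
    have h := P.rel (u.map (Pre.eval P f)) (v.map (Pre.eval P f)) (w.map (Pre.eval P f))
      (by simpa using hu) (by simpa using hv) (by simpa using hw')
    rw [allBlockCuts_map, allBlockCuts_map, List.map_map, List.map_map] at h
    rw [Pre.eval_sum, Pre.eval_sum, List.map_map, List.map_map]
    simpa only [Function.comp_def, Pre.eval_M, hw] using h
  | M_nil_nil => simpa [Pre.eval_M, Pre.eval] using P.M_nil_nil
  | M_singleton_nil => simpa [Pre.eval_M] using P.M_singleton_nil _
  | M_nil_singleton => simpa [Pre.eval_M] using P.M_nil_singleton _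
  | M_add_left => simp [Pre.eval_M, Pre.eval, P.M_add_left]
  | M_add_right => simp [Pre.eval_M, Pre.eval, P.M_add_right]
  | M_smul_left => simp [Pre.eval_M, Pre.eval, P.M_smul_left]
  | M_smul_right => simp [Pre.eval_M, Pre.eval, P.M_smul_right]
  | M_congr_left => simp_all [Pre.eval_M]
  | M_congr_right => simp_all [Pre.eval_M]
  | _ => simp_all [Pre.eval]

/-- `B∞(V)` is free: every linear map from `V` to a `B∞`-algebra extends uniquely to a
homomorphism. -/
theorem existsUnique_lift {R : Type w} [AddCommGroup R] [Module K R] (P : BInfAlgebra K R)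
    (f : V →ₗ[K] R) :
    ∃! F : FreeBInf K V →ₗ[K] R, (str K V).IsHom P F ∧ ∀ x, F (ι K V x) = f x := by
  refine ⟨{ toFun := Quotient.lift (Pre.eval P f) fun _ _ h => Rel.eval_eq P f h
            map_add' := by rintro ⟨a⟩ ⟨b⟩; rfl
            map_smul' := by rintro c ⟨a⟩; rfl }, ⟨?_, fun _ => rfl⟩, ?_⟩
  · intro u v
    obtain ⟨u, rfl⟩ := exists_map_mk K V u
    obtain ⟨v, rfl⟩ := exists_map_mk K V v
    have h : (str K V).M (u.map (mk K V)) (v.map (mk K V)) = mk K V (Pre.M u v) := M_mk K V u v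
    rw [h, List.map_map, List.map_map]
    exact Pre.eval_M P f u v
  · rintro G ⟨hG, hG'⟩
    ext ⟨a⟩
    change G (mk K V a) = Pre.eval P f a
    induction a with
    | of x => exact hG' x
    | zero => exact map_zero G
    | add a b iha ihb => exact (map_add G (mk K V a) (mk K V b)).trans (by rw [iha, ihb]; rfl)
    | smul c a ih => exact (map_smul G c (mk K V a)).trans (by rw [ih]; rfl)
    | op p q a b iha ihb =>
      have h : Pre.op p q a b = Pre.M (List.ofFn a) (List.ofFn b) := by
        have key : ∀ {p p' q q' : ℕ} (hp : p' = p) (hq : q' = q) (a : Fin p → Pre K V)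
            (b : Fin q → Pre K V), Pre.op p q a b =
              Pre.op p' q' (fun i => a (Fin.cast hp i)) (fun i => b (Fin.cast hq i)) := by
          rintro p _ q _ rfl rfl a b; rfl
        rw [key (List.length_ofFn (f := a)) (List.length_ofFn (f := b)) a b, Pre.M]
        congr 1 <;> funext i <;> simp [Fin.cast]
      rw [h, ← M_mk, Pre.eval_M]
      refine (hG _ _).trans ?_
      simp only [List.map_ofFn, Function.comp_def, iha, ihb]

end

end FreeBInf

/-! ## The `B∞`-operations of a 2-associative algebra -/

/-- The product `u₁ · u₂ · … · u_n`. -/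
def TwoAssocData.dotProd {K : Type u} {A : Type v} [Field K] [AddCommGroup A] [Module K A]
    (O : TwoAssocData K A) (u : List A) : A :=
  u.foldr (fun a b => O.dot a b) O.one

/-- The operations `M_pq` of a 2-associative algebra, defined by induction on `p + q`: for
`p, q ≥ 1` one subtracts from `(u₁ · … · u_p) * (v₁ · … · v_q)` the products
`M_{i₁j₁}(…) · … · M_{i_kj_k}(…)` over all cuts into `k ≥ 2` blocks. (The attached membership
proofs only serve the termination of the recursion.) -/
def TwoAssocData.M {K : Type u} {A : Type v} [Field K] [AddCommGroup A] [Module K A]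
    (O : TwoAssocData K A) : List A → List A → A
  | [], [] => 0
  | [a], [] => a
  | [], [b] => b
  | _ :: _ :: _, [] => 0
  | [], _ :: _ :: _ => 0
  | a :: u, b :: v =>
    O.star (O.dotProd (a :: u)) (O.dotProd (b :: v)) -
      (((allBlockCuts (a :: u) (b :: v)).filter fun c => 2 ≤ c.length).attach.map fun c =>
        O.dotProd (c.1.attach.map fun x => TwoAssocData.M O x.1.1 x.1.2)).sum
termination_by u v => u.length + v.length
decreasing_by
  have hc := List.mem_filter.mp c.2
  exact length_lt_of_mem_allBlockCuts hc.1 (by simpa using hc.2) x.2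

theorem TwoAssocData.M_cons_cons {K : Type u} {A : Type v} [Field K] [AddCommGroup A] [Module K A]
    (O : TwoAssocData K A) (a b : A) (u v : List A) :
    O.M (a :: u) (b :: v) = O.star (O.dotProd (a :: u)) (O.dotProd (b :: v)) -
      (((allBlockCuts (a :: u) (b :: v)).filter fun c => 2 ≤ c.length).map fun c =>
        O.dotProd (blockWord O.M c)).sum := by
  rw [TwoAssocData.M]
  have h (c : List (List A × List A)) :
      (c.attach.map fun x => O.M x.1.1 x.1.2) = blockWord O.M c :=
    List.attach_map_val (f := fun x : List A × List A => O.M x.1 x.2)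
  simp only [h]
  rw [List.attach_map_val (f := fun c => O.dotProd (blockWord O.M c))]

/-! ## The 2-associative bialgebra `T^{fc}(R)` of a `B∞`-algebra `R` -/

namespace Tfc

section

variable {K : Type u} {R : Type v} [Field K] [AddCommGroup R] [Module K R]

/-- A function of words is multilinear if, on words of every length, it is linear in each letter. -/
def IsMultilin (K : Type u) {R : Type v} {N : Type w} [Field K] [AddCommGroup R] [Module K R]
    [AddCommGroup N] [Module K N] (F : List R → N) : Prop :=
  ∀ l m, IsLinearMap K fun x => F (l ++ x :: m)

theorem ofFn_update {X : Type v} {n : ℕ} (f : Fin n → X) (i : Fin n) (x : X) (inst : DecidableEq (Fin n)) :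
    List.ofFn (@Function.update _ _ inst f i x) =
      (List.ofFn f).take i ++ x :: (List.ofFn f).drop (i + 1) := by
  have h := List.set_eq_take_append_cons_drop (l := List.ofFn f) (i := i) (a := x)
  rw [if_pos (by simp)] at h
  rw [← h]
  apply List.ext_getElem
  · simp
  · intro k h1 h2
    rw [List.getElem_set]
    simp only [List.getElem_ofFn, Function.update_apply, Fin.ext_iff]
    split_ifs <;> first | rfl | omega

/-- The linear map on `T(R)` with prescribed multilinear values on words. -/
def wordLift {N : Type w} [AddCommGroup N] [Module K N] (F : List R → N) (hF : IsMultilin K F) :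
    TensorAlgebra K R →ₗ[K] N :=
  (DirectSum.toModule K ℕ N fun n => PiTensorProduct.lift
    { toFun := fun f : Fin n → R => F (List.ofFn f)
      map_update_add' := by
        intro inst f i x y
        rw [ofFn_update, ofFn_update, ofFn_update]
        exact (hF _ _).map_add x y
      map_update_smul' := by
        intro inst f i c x
        rw [ofFn_update, ofFn_update]
        exact (hF _ _).map_smul c x }).comp
  (TensorAlgebra.equivDirectSum (R := K) (M := R)).toLinearMap

variable (K) in
/-- The word `u₁ ⊗ ⋯ ⊗ u_n`, as an element of `T(R)`. -/
def word (u : List R) : TensorAlgebra K R := (u.map (TensorAlgebra.ι K)).prod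

theorem wordLift_word {N : Type w} [AddCommGroup N] [Module K N] (F : List R → N)
    (hF : IsMultilin K F) (u : List R) : wordLift F hF (word K u) = F u := by
  have h : word K u = TensorAlgebra.tprod K R u.length u.get := by
    rw [TensorAlgebra.tprod_apply, word]
    conv_lhs => rw [← List.ofFn_get u, List.map_ofFn]
    rfl
  rw [h]
  simp only [wordLift, LinearMap.comp_apply]
  change DirectSum.toModule K ℕ N _ (TensorAlgebra.toDirectSum _) = _
  rw [TensorAlgebra.toDirectSum_tensorPower_tprod, ← DirectSum.lof_eq_of K,
    DirectSum.toModule_lof, PiTensorProduct.lift.tprod]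
  exact congrArg F (List.ofFn_get u)

theorem isLinearMap_sum {ι : Type*} {N : Type w} [AddCommGroup N] [Module K N] (L : List ι)
    (f : ι → R → N) (hf : ∀ i, IsLinearMap K (f i)) :
    IsLinearMap K fun x => (L.map fun i => f i x).sum := by
  induction L with
  | nil => exact ⟨by simp, by simp⟩
  | cons i L ih =>
    simp only [List.map_cons, List.sum_cons]
    exact ⟨fun x y => by rw [(hf i).map_add, ih.map_add]; abel,
      fun c x => by rw [(hf i).map_smul, ih.map_smul, smul_add]⟩

theorem take_drop_of_le {X : Type v} {l m : List X} {i : ℕ} (h : i ≤ l.length) (x : X) :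
    (l ++ x :: m).take i = l.take i ∧ (l ++ x :: m).drop i = l.drop i ++ x :: m :=
  ⟨List.take_append_of_le_length h, List.drop_append_of_le_length h⟩

theorem take_drop_of_lt {X : Type v} {l m : List X} {i : ℕ} (h : l.length < i) (x : X) :
    (l ++ x :: m).take i = l ++ x :: m.take (i - l.length - 1) ∧
      (l ++ x :: m).drop i = m.drop (i - l.length - 1) := by
  obtain ⟨j, rfl⟩ := Nat.exists_eq_add_of_lt h
  have : l.length + j + 1 - l.length - 1 = j := by omega
  rw [this, List.take_append, List.drop_append, List.take_of_length_le (by omega),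
    List.drop_of_length_le (by omega)]
  have : l.length + j + 1 - l.length = j + 1 := by omega
  rw [this]
  exact ⟨rfl, rfl⟩

theorem isMultilin_word : IsMultilin K (word K : List R → TensorAlgebra K R) := by
  intro l m
  simp only [word, List.map_append, List.map_cons, List.prod_append, List.prod_cons]
  exact ⟨fun x y => by rw [map_add, add_mul, mul_add], fun c x => by
    rw [map_smul, smul_mul_assoc, mul_smul_comm]⟩

/-- Deconcatenation on words: `Δ(u₁…u_n) = ∑_{i=0}^n u₁…u_i ⊗ u_{i+1}…u_n`. -/
def comulWord (u : List R) : TensorAlgebra K R ⊗[K] TensorAlgebra K R :=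
  ((List.range (u.length + 1)).map fun i => word K (u.take i) ⊗ₜ[K] word K (u.drop i)).sum

theorem isMultilin_comulWord :
    IsMultilin K (comulWord : List R → TensorAlgebra K R ⊗[K] TensorAlgebra K R) := by
  intro l m
  simp only [comulWord, List.length_append, List.length_cons]
  refine isLinearMap_sum _ _ fun i => ?_
  rcases le_or_gt i l.length with h | h
  · simp only [take_drop_of_le h]
    have := isMultilin_word (K := K) (l.drop i) m
    exact ⟨fun x y => by rw [this.map_add, TensorProduct.tmul_add],
      fun c x => by rw [this.map_smul, TensorProduct.tmul_smul]⟩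
  · simp only [take_drop_of_lt h]
    have := isMultilin_word (K := K) l (m.take (i - l.length - 1))
    exact ⟨fun x y => by rw [this.map_add, TensorProduct.add_tmul],
      fun c x => by rw [this.map_smul, TensorProduct.smul_tmul']⟩

/-- The product on words:
`u₁…u_p * v₁…v_q = ∑_k ∑_{(i,j)} M_{i₁j₁}(…) M_{i₂j₂}(…) ⋯ M_{i_kj_k}(…)`. -/
def starWord (P : BInfAlgebra K R) (u v : List R) : TensorAlgebra K R :=
  ((allBlockCuts u v).map fun c => word K (blockWord P.M c)).sum

/-- The part of the product with a fixed number `k` of blocks. -/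
def starWordAux (P : BInfAlgebra K R) (k : ℕ) (u v : List R) : TensorAlgebra K R :=
  ((blockCuts k u v).map fun c => word K (blockWord P.M c)).sum

theorem sum_flatMap {ι : Type*} {X : Type*} {N : Type w} [AddCommGroup N] (L : List ι)
    (f : ι → List X) (g : X → N) :
    ((L.flatMap f).map g).sum = (L.map fun i => ((f i).map g).sum).sum := by
  induction L with
  | nil => rfl
  | cons i L ih =>
    rw [List.flatMap_cons, List.map_append, List.sum_append, ih, List.map_cons, List.sum_cons]

theorem starWord_eq (P : BInfAlgebra K R) (u v : List R) :
    starWord P u v =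
      ((List.range (u.length + v.length + 1)).map fun k => starWordAux P k u v).sum :=
  sum_flatMap _ _ _

theorem starWordAux_succ (P : BInfAlgebra K R) (k : ℕ) (u v : List R) :
    starWordAux P (k + 1) u v = ((List.range (u.length + 1)).map fun i =>
      ((List.range (v.length + 1)).map fun j => if i + j = 0 then 0 else
        TensorAlgebra.ι K (P.M (u.take i) (v.take j)) *
          starWordAux P k (u.drop i) (v.drop j)).sum).sum := by
  simp only [starWordAux, blockCuts, sum_flatMap]
  congr 2; funext i; congr 2; funext j
  split_ifs with h
  · rfl
  · rw [List.map_map, ← List.sum_map_mul_left]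
    rfl

theorem isMultilin_starWordAux (P : BInfAlgebra K R) (k : ℕ) :
    (∀ v, IsMultilin K fun u => starWordAux P k u v) ∧
      ∀ u, IsMultilin K fun v => starWordAux P k u v := by
  induction k with
  | zero =>
    constructor
    · intro v l m
      have : ∀ x, starWordAux P 0 (l ++ x :: m) v = 0 := by
        intro x; simp [starWordAux, blockCuts]
      simp only [this]
      exact ⟨by simp, by simp⟩
    · intro v l m
      have : ∀ x, starWordAux P 0 v (l ++ x :: m) = 0 := by
        intro x; simp [starWordAux, blockCuts]
      simp only [this]
      exact ⟨by simp, by simp⟩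
  | succ k ih =>
    constructor
    · intro v l m
      simp only [starWordAux_succ, List.length_append, List.length_cons]
      refine isLinearMap_sum _ _ fun i => isLinearMap_sum _ _ fun j => ?_
      split_ifs with hij
      · exact ⟨by simp, by simp⟩
      · rcases le_or_gt i l.length with h | h
        · simp only [take_drop_of_le h]
          have : IsLinearMap K fun x => starWordAux P k (l.drop i ++ x :: m) (v.drop j) :=
            ih.1 (v.drop j) (l.drop i) m
          exact ⟨fun x y => by rw [this.map_add, mul_add],
            fun c x => by rw [this.map_smul, mul_smul_comm]⟩
        · simp only [take_drop_of_lt h]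
          exact ⟨fun x y => by rw [P.M_add_left, map_add, add_mul],
            fun c x => by rw [P.M_smul_left, map_smul, smul_mul_assoc]⟩
    · intro u l m
      simp only [starWordAux_succ, List.length_append, List.length_cons]
      refine isLinearMap_sum _ _ fun i => isLinearMap_sum _ _ fun j => ?_
      split_ifs with hij
      · exact ⟨by simp, by simp⟩
      · rcases le_or_gt j l.length with h | h
        · simp only [take_drop_of_le h]
          have : IsLinearMap K fun x => starWordAux P k (u.drop i) (l.drop j ++ x :: m) :=
            ih.2 (u.drop i) (l.drop j) m
          exact ⟨fun x y => by rw [this.map_add, mul_add],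
            fun c x => by rw [this.map_smul, mul_smul_comm]⟩
        · simp only [take_drop_of_lt h]
          exact ⟨fun x y => by rw [P.M_add_right, map_add, add_mul],
            fun c x => by rw [P.M_smul_right, map_smul, smul_mul_assoc]⟩

theorem isMultilin_starWord_left (P : BInfAlgebra K R) (v : List R) :
    IsMultilin K fun u => starWord P u v := by
  intro l m
  simp only [starWord_eq, List.length_append, List.length_cons]
  exact isLinearMap_sum _ _ fun k => (isMultilin_starWordAux P k).1 v l m

theorem isMultilin_starWord_right (P : BInfAlgebra K R) (u : List R) :
    IsMultilin K fun v => starWord P u v := by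
  intro l m
  simp only [starWord_eq, List.length_append, List.length_cons]
  exact isLinearMap_sum _ _ fun k => (isMultilin_starWordAux P k).2 u l m

theorem ext_word {N : Type w} [AddCommGroup N] [Module K N] {f g : TensorAlgebra K R →ₗ[K] N}
    (h : ∀ u, f (word K u) = g (word K u)) : f = g := by
  have key : f.comp (TensorAlgebra.equivDirectSum (R := K) (M := R)).symm.toLinearMap =
      g.comp (TensorAlgebra.equivDirectSum (R := K) (M := R)).symm.toLinearMap := by
    refine DirectSum.linearMap_ext K fun n => PiTensorProduct.ext ?_
    ext x
    have hx : (TensorAlgebra.equivDirectSum (R := K) (M := R)).symm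
        (DirectSum.lof K ℕ (fun n => ⨂[K]^n R) n (PiTensorProduct.tprod K x)) =
        word K (List.ofFn x) := by
      refine (TensorAlgebra.ofDirectSum_of_tprod x).trans ?_
      rw [TensorAlgebra.tprod_apply, word, List.map_ofFn]
      rfl
    have := h (List.ofFn x)
    rw [← hx] at this
    exact this
  ext x
  have := LinearMap.congr_fun key (TensorAlgebra.equivDirectSum x)
  simpa using this

/-- The product on words, extended linearly in the second factor. -/
def starRight (P : BInfAlgebra K R) (u : List R) : TensorAlgebra K R →ₗ[K] TensorAlgebra K R :=
  wordLift (starWord P u) (isMultilin_starWord_right P u)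

theorem isMultilin_starRight (P : BInfAlgebra K R) : IsMultilin K (starRight P) := fun l m =>
  ⟨fun x y => ext_word fun v => by
      simp only [starRight, wordLift_word, LinearMap.add_apply]
      exact (isMultilin_starWord_left P v l m).map_add x y,
    fun c x => ext_word fun v => by
      simp only [starRight, wordLift_word, LinearMap.smul_apply]
      exact (isMultilin_starWord_left P v l m).map_smul c x⟩

end

end Tfc

/-- The 2-associative bialgebra `T^{fc}(R)` of a `B∞`-algebra `R`: on the tensor module `T(R)`, the
product `*` determined by the operations of `R`, the concatenation product `·`, and the
deconcatenation coproduct. -/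
def tfc {K : Type u} {R : Type v} [Field K] [AddCommGroup R] [Module K R] (P : BInfAlgebra K R) :
    TwoAssocBialgData K (TensorAlgebra K R) where
  one := 1
  star := Tfc.wordLift (Tfc.starRight P) (Tfc.isMultilin_starRight P)
  dot := LinearMap.mul K (TensorAlgebra K R)
  comul := Tfc.wordLift Tfc.comulWord Tfc.isMultilin_comulWord
  counit := (TensorAlgebra.algebraMapInv (R := K) (M := R)).toLinearMap

theorem tfc_star_word {K : Type u} {R : Type v} [Field K] [AddCommGroup R] [Module K R]
    (P : BInfAlgebra K R) (u v : List R) :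
    (tfc P).star (Tfc.word K u) (Tfc.word K v) =
      ((allBlockCuts u v).map fun c => Tfc.word K (blockWord P.M c)).sum := by
  have h := Tfc.wordLift_word (Tfc.starRight P) (Tfc.isMultilin_starRight P) u
  change Tfc.wordLift (Tfc.starRight P) (Tfc.isMultilin_starRight P) (Tfc.word K u) _ = _
  rw [h]
  exact Tfc.wordLift_word _ (Tfc.isMultilin_starWord_right P u) v

theorem tfc_comul_word {K : Type u} {R : Type v} [Field K] [AddCommGroup R] [Module K R]
    (P : BInfAlgebra K R) (u : List R) :
    (tfc P).comul (Tfc.word K u) =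
      ((List.range (u.length + 1)).map fun i =>
        Tfc.word K (u.take i) ⊗ₜ[K] Tfc.word K (u.drop i)).sum :=
  Tfc.wordLift_word _ Tfc.isMultilin_comulWord u

end

/-! The bridge between the two structures is the formula for `*` on words. Given operations `M` on
pairs of words in `R`, with `M [] [] = 0`, splitting off the first block of a cut gives, for `(u,
v)` not both empty, the recursion `u * v = ∑ M(a, c) · (b * d)` over all splittings `u = ab`, `v =
cd` (`cutProd_rec`). It follows that `*` respects deconcatenation (`deconc_cutProd`) and that the
component of `u * v` in `R` is `M u v` (`letters_cutProd`).

Both `(u * v) * w` and `u * (v * w)` then satisfy a recursion of the same shape, whose first letters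
are the two sides of the relation `R_ijk`. So if the relations hold for shorter words, the
associator of three words is a single letter, the difference of the two sides of their relation
(`starProd_sub_starProd`). This is used twice. If `R` is a `B∞`-algebra, the associator vanishes and
`T^{fc}(R)` is a 2-associative bialgebra. If `A` is any 2-associative algebra, multiplying letters
with `·` gives a map `T(A) → A` that carries the products built from the operations `M_pq` of `A` to
those of `A`. Since `*` is associative in `A`, the letter, which this map leaves unchanged, is zero.
By induction on total length all of `A` is a `B∞`-algebra (`TwoAssocData.bInf`).

A `B∞`-homomorphism `R → A` extends multiplicatively for `·` to a homomorphism `T^{fc}(R) → A` of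
2-associative algebras (`extend_isHom`), and `R → T^{fc}(R)` is itself a `B∞`-homomorphism
(`M_map_ι`). For `R = B∞(V)` and `A = 2as(V)`, the universal properties of the two free objects
yield maps `2as(V) ⇄ T^{fc}(B∞(V))`, which are mutually inverse because they are so on generators.

The map from `2as(V)` sends `V` to primitive elements, so it respects the recursively defined
coproduct, and `2as(V)` inherits coassociativity and the counit laws. The primitive elements for
deconcatenation are the letters (`exists_ι_of_deconc`, `deconc_ι`); hence `Prim(2as(V))` corresponds
to `B∞(V)`, compatibly with the operations. -/

noncomputable section

/-! ## Sums over the splittings of a word -/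

/-- The sum of `f a b` over all ways of writing the word `u` as `a ++ b`. -/
def splitSum {X : Type v} {N : Type w} [AddCommGroup N] (u : List X)
    (f : List X → List X → N) : N :=
  ((List.range (u.length + 1)).map fun i => f (u.take i) (u.drop i)).sum

namespace splitSum

variable {X : Type v} {N : Type w} [AddCommGroup N]

theorem nil (f : List X → List X → N) : splitSum [] f = f [] [] := by
  simp [splitSum]

theorem cons (x : X) (u : List X) (f : List X → List X → N) :
    splitSum (x :: u) f = f [] (x :: u) + splitSum u fun a b => f (x :: a) b := by
  rw [splitSum, List.length_cons, List.range_succ_eq_map]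
  simp [splitSum, Function.comp_def]

theorem congr {u : List X} {f g : List X → List X → N}
    (h : ∀ a b, a ++ b = u → f a b = g a b) : splitSum u f = splitSum u g := by
  simp only [splitSum, h _ _ (List.take_append_drop _ u)]

theorem zero (u : List X) : (splitSum u fun _ _ => (0 : N)) = 0 := by
  simp [splitSum]

theorem add (u : List X) (f g : List X → List X → N) :
    (splitSum u fun a b => f a b + g a b) = splitSum u f + splitSum u g := by
  simp only [splitSum, List.sum_map_add]

theorem map {N' : Type*} [AddCommGroup N'] {F : Type*} [FunLike F N N'] [AddMonoidHomClass F N N']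
    (φ : F) (u : List X) (f : List X → List X → N) :
    φ (splitSum u f) = splitSum u fun a b => φ (f a b) := by
  simp [splitSum, map_list_sum, Function.comp_def]

theorem map_apply {K : Type u} [Field K] [Module K N] {M P : Type*} [AddCommGroup M] [Module K M]
    [AddCommGroup P] [Module K P] (φ : N →ₗ[K] M →ₗ[K] P) (u : List X)
    (f : List X → List X → N) (y : M) :
    φ (splitSum u f) y = splitSum u fun a b => φ (f a b) y :=
  map (φ.flip y) u f

theorem tmul_right {K : Type u} [Field K] [Module K N] {M : Type*} [AddCommGroup M] [Module K M]
    (u : List X) (f : List X → List X → N) (y : M) :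
    splitSum u f ⊗ₜ[K] y = splitSum u fun a b => f a b ⊗ₜ[K] y :=
  map_apply (TensorProduct.mk K N M) u f y

theorem tmul_left {K : Type u} [Field K] [Module K N] {M : Type*} [AddCommGroup M] [Module K M]
    (u : List X) (f : List X → List X → N) (y : M) :
    y ⊗ₜ[K] splitSum u f = splitSum u fun a b => y ⊗ₜ[K] f a b :=
  map (TensorProduct.mk K M N y) u f

theorem sub (u : List X) (f g : List X → List X → N) :
    (splitSum u fun a b => f a b - g a b) = splitSum u f - splitSum u g := by
  induction u generalizing f g with
  | nil => simp only [nil]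
  | cons x u ih => simp only [cons, ih]; abel

theorem comm {Y : Type*} (u : List X) (v : List Y) (f : List X → List X → List Y → List Y → N) :
    (splitSum u fun a b => splitSum v fun c d => f a b c d) =
      splitSum v fun c d => splitSum u fun a b => f a b c d := by
  induction u generalizing f with
  | nil => simp only [nil]
  | cons x u ih => simp only [cons, ih, add]

/-- Both sides run over the ways of writing `u` as three consecutive subwords; this is the
coassociativity of deconcatenation. -/
theorem assoc (u : List X) (f : List X → List X → List X → N) :
    (splitSum u fun a b => splitSum a fun c d => f c d b) =
      splitSum u fun a b => splitSum b fun c d => f a c d := by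
  induction u generalizing f with
  | nil => simp only [nil]
  | cons x u ih => simp only [cons, nil, add, ih, add_assoc]

/-- The cut falls either in `v` or in `u`, and the cut at the junction is counted in both sums. The
subtracted term becomes the `- x ⊗ y` of the infinitesimal compatibility. -/
theorem append (u v : List X) (f : List X → List X → N) :
    splitSum (u ++ v) f = (splitSum v fun a b => f (u ++ a) b) +
      (splitSum u fun a b => f a (b ++ v)) - f u v := by
  induction u generalizing f with
  | nil => simp [nil]
  | cons x u ih => simp only [List.cons_append, cons, ih]; abel

theorem eq_zero {u : List X} {f : List X → List X → N} (h : ∀ a b, a ++ b = u → f a b = 0) :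
    splitSum u f = 0 := by
  rw [congr h, zero]

/-- Applied in each variable in turn, this isolates the term in which the first block is everything.
-/
theorem eq_last {u : List X} {f : List X → List X → N}
    (h : ∀ a b, a ++ b = u → b ≠ [] → f a b = 0) : splitSum u f = f u [] := by
  induction u generalizing f with
  | nil => exact nil f
  | cons x u ih =>
    rw [cons, h [] _ rfl (by simp), zero_add, ih]
    exact fun a b hab hb => h _ _ (by simp [hab]) hb

/-- Sums over splittings of multilinear expressions are multilinear. -/
theorem isMultilin {K : Type u} {R : Type v} [Field K] [AddCommGroup R] [Module K R] [Module K N]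
    {f : List R → List R → N} (hl : ∀ b, Tfc.IsMultilin K fun a => f a b)
    (hr : ∀ a, Tfc.IsMultilin K fun b => f a b) : Tfc.IsMultilin K fun u => splitSum u f := by
  intro l m
  simp only [splitSum, List.length_append, List.length_cons]
  refine Tfc.isLinearMap_sum _ _ fun i => ?_
  -- The letter that varies lies in the right part when the cut comes before it, and otherwise in
  -- the left part.
  rcases le_or_gt i l.length with h | h
  · simp only [Tfc.take_drop_of_le h]
    exact hr _ _ _
  · simp only [Tfc.take_drop_of_lt h]
    exact hl _ _ _

end splitSum

/-! ### Words as a spanning set of the tensor module, and bilinear extension -/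

namespace Tfc

variable {K : Type u} {R : Type v} [Field K] [AddCommGroup R] [Module K R]
variable {N : Type w} [AddCommGroup N] [Module K N]

theorem IsMultilin.splitSum {X : Type*} {f : List R → List X → List X → N} (u : List X)
    (h : ∀ a b, IsMultilin K fun x => f x a b) : IsMultilin K fun x => splitSum u (f x) :=
  fun l m => isLinearMap_sum _ _ fun _ => h _ _ l m

theorem IsMultilin.comp {N' : Type*} [AddCommGroup N'] [Module K N'] {f : List R → N}
    (h : IsMultilin K f) (g : N →ₗ[K] N') : IsMultilin K fun x => g (f x) := fun l m =>
  ⟨fun x y => (congrArg g ((h l m).map_add x y)).trans (map_add g _ _),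
    fun c x => (congrArg g ((h l m).map_smul c x)).trans (map_smul g _ _)⟩

theorem word_nil : word K ([] : List R) = 1 := rfl

theorem word_singleton (a : R) : word K [a] = TensorAlgebra.ι K a := by simp [word]

theorem word_cons (a : R) (u : List R) : word K (a :: u) = TensorAlgebra.ι K a * word K u := by
  simp [word]

theorem word_append (u v : List R) : word K (u ++ v) = word K u * word K v := by
  simp [word]

/-- The quotient map by the span kills every word, and a linear map on `T(R)` is determined by its
values on words. -/
theorem span_range_word : Submodule.span K (Set.range (word K : List R → TensorAlgebra K R)) = ⊤ := by
  rw [← Submodule.ker_mkQ (Submodule.span K (Set.range (word K : List R → TensorAlgebra K R))),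
    LinearMap.ker_eq_top]
  refine ext_word fun u => ?_
  rw [LinearMap.zero_apply, Submodule.mkQ_apply, Submodule.Quotient.mk_eq_zero]
  exact Submodule.subset_span ⟨u, rfl⟩

theorem word_induction {p : TensorAlgebra K R → Prop} (word : ∀ u, p (word K u))
    (zero : p 0) (add : ∀ x y, p x → p y → p (x + y)) (smul : ∀ (c : K) x, p x → p (c • x))
    (x : TensorAlgebra K R) : p x := by
  have hx : x ∈ Submodule.span K (Set.range (Tfc.word K : List R → TensorAlgebra K R)) := by
    rw [span_range_word]; trivial
  induction hx using Submodule.span_induction with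
  | mem x h => obtain ⟨u, rfl⟩ := h; exact word u
  | zero => exact zero
  | add x y _ _ hx hy => exact add x y hx hy
  | smul c x _ hx => exact smul c x hx

theorem ext_word₂ {f g : TensorAlgebra K R →ₗ[K] TensorAlgebra K R →ₗ[K] N}
    (h : ∀ u v, f (word K u) (word K v) = g (word K u) (word K v)) : f = g :=
  ext_word fun u => ext_word fun v => h u v

theorem isMultilin_wordLift (F : List R → List R → N) (hl : ∀ v, IsMultilin K fun u => F u v)
    (hr : ∀ u, IsMultilin K (F u)) : IsMultilin K fun u => wordLift (F u) (hr u) := fun l m =>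
  ⟨fun x y => ext_word fun v => by
      simp only [wordLift_word, LinearMap.add_apply]
      exact (hl v l m).map_add x y,
    fun c x => ext_word fun v => by
      simp only [wordLift_word, LinearMap.smul_apply]
      exact (hl v l m).map_smul c x⟩

/-- The bilinear map on `T(R) × T(R)` with prescribed multilinear values on pairs of words. -/
def wordLift₂ (F : List R → List R → N) (hl : ∀ v, IsMultilin K fun u => F u v)
    (hr : ∀ u, IsMultilin K (F u)) : TensorAlgebra K R →ₗ[K] TensorAlgebra K R →ₗ[K] N :=
  wordLift (fun u => wordLift (F u) (hr u)) (isMultilin_wordLift F hl hr)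

theorem wordLift₂_word (F : List R → List R → N) (hl : ∀ v, IsMultilin K fun u => F u v)
    (hr : ∀ u, IsMultilin K (F u)) (u v : List R) :
    wordLift₂ F hl hr (word K u) (word K v) = F u v := by
  rw [wordLift₂, wordLift_word, wordLift_word]

end Tfc

/-! ## Deconcatenation -/

namespace Tfc

section Comul

variable (K : Type u) (R : Type v) [Field K] [AddCommGroup R] [Module K R]

/-- The deconcatenation coproduct on `T(R)`. -/
def deconc : TensorAlgebra K R →ₗ[K] TensorAlgebra K R ⊗[K] TensorAlgebra K R :=
  wordLift comulWord isMultilin_comulWord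

/-- The projection of `T(R)` onto `K`. -/
def augm : TensorAlgebra K R →ₗ[K] K :=
  (TensorAlgebra.algebraMapInv (R := K) (M := R)).toLinearMap

/-- The letter of a word of length one, and zero for words of other lengths. -/
def letter : List R → R
  | [a] => a
  | _ => 0

variable {R} in
theorem isMultilin_letter : IsMultilin K (letter R) := by
  rintro l m
  match l, m with
  | [], [] => exact ⟨fun _ _ => rfl, fun _ _ => rfl⟩
  | [], b :: m => exact ⟨fun _ _ => by simp [letter], fun _ _ => by simp [letter]⟩
  | [a], m => exact ⟨fun _ _ => by simp [letter], fun _ _ => by simp [letter]⟩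
  | a :: b :: l, m => exact ⟨fun _ _ => by simp [letter], fun _ _ => by simp [letter]⟩

/-- The projection of `T(R)` onto `R`. -/
def letters : TensorAlgebra K R →ₗ[K] R := wordLift (letter R) (isMultilin_letter K)

variable {K R}

theorem deconc_word (u : List R) :
    deconc K R (word K u) = splitSum u fun a b => word K a ⊗ₜ[K] word K b :=
  wordLift_word _ _ u

theorem augm_one : augm K R 1 = 1 := map_one (TensorAlgebra.algebraMapInv (R := K) (M := R))

theorem augm_mul (x y : TensorAlgebra K R) : augm K R (x * y) = augm K R x * augm K R y :=
  map_mul (TensorAlgebra.algebraMapInv (R := K) (M := R)) x y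

theorem augm_ι (a : R) : augm K R (TensorAlgebra.ι K a) = 0 := by
  simp [augm, TensorAlgebra.algebraMapInv]

theorem augm_word (u : List R) : augm K R (word K u) = if u = [] then 1 else 0 := by
  cases u with
  | nil => simp [word_nil, augm_one]
  | cons a u => simp [word_cons, augm_mul, augm_ι]

theorem letters_word (u : List R) : letters K R (word K u) = letter R u := wordLift_word _ _ u

theorem letters_ι (a : R) : letters K R (TensorAlgebra.ι K a) = a := by
  rw [← word_singleton, letters_word]; rfl

theorem letters_one : letters K R 1 = 0 := by
  rw [← word_nil, letters_word]; rfl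

/-- Only the constant part of `x` can follow `a` in a word of length one. -/
theorem letters_ι_mul (a : R) (x : TensorAlgebra K R) :
    letters K R (TensorAlgebra.ι K a * x) = augm K R x • a := by
  induction x using word_induction with
  | word u =>
    rw [← word_cons, letters_word, augm_word]
    cases u <;> simp [letter]
  | zero => simp
  | add x y hx hy => simp [mul_add, hx, hy, add_smul]
  | smul c x hx => simp [hx, mul_smul]

theorem deconc_one : deconc K R 1 = 1 ⊗ₜ[K] 1 := by
  rw [← word_nil, deconc_word, splitSum.nil]

theorem deconc_coassoc (x : TensorAlgebra K R) :
    TensorProduct.assoc K _ _ _ ((deconc K R).rTensor _ (deconc K R x)) =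
      (deconc K R).lTensor _ (deconc K R x) := by
  induction x using word_induction with
  | word u =>
    simp only [deconc_word, splitSum.map, LinearMap.rTensor_tmul, LinearMap.lTensor_tmul]
    simp only [splitSum.tmul_left, splitSum.tmul_right, splitSum.map, TensorProduct.assoc_tmul]
    exact splitSum.assoc u fun a b c => word K a ⊗ₜ[K] (word K b ⊗ₜ[K] word K c)
  | zero => simp
  | add x y hx hy => simp only [map_add, hx, hy]
  | smul c x hx => simp only [map_smul, hx]

theorem augm_deconc (x : TensorAlgebra K R) :
    TensorProduct.lid K _ ((augm K R).rTensor _ (deconc K R x)) = x := by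
  induction x using word_induction with
  | word u =>
    simp only [deconc_word, splitSum.map, LinearMap.rTensor_tmul, TensorProduct.lid_tmul,
      augm_word]
    cases u with
    | nil => simp [splitSum.nil]
    | cons a u => simp [splitSum.cons, splitSum.zero]
  | zero => simp
  | add x y hx hy => simp only [map_add, hx, hy]
  | smul c x hx => simp only [map_smul, hx]

theorem deconc_augm (x : TensorAlgebra K R) :
    TensorProduct.rid K _ ((augm K R).lTensor _ (deconc K R x)) = x := by
  induction x using word_induction with
  | word u =>
    simp only [deconc_word, splitSum.map, LinearMap.lTensor_tmul, TensorProduct.rid_tmul,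
      augm_word]
    rw [splitSum.eq_last]
    · simp
    · intro a b _ hb; simp [hb]
  | zero => simp
  | add x y hx hy => simp only [map_add, hx, hy]
  | smul c x hx => simp only [map_smul, hx]

theorem deconc_mul (x y : TensorAlgebra K R) :
    deconc K R (x * y) =
      TensorProduct.map₂ (LinearMap.mul K _) (LinearMap.mul K _) (x ⊗ₜ[K] 1) (deconc K R y) +
      TensorProduct.map₂ (LinearMap.mul K _) (LinearMap.mul K _) (deconc K R x) (1 ⊗ₜ[K] y) -
      x ⊗ₜ[K] y := by
  induction x using word_induction with
  | word u =>
    induction y using word_induction with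
    | word v =>
      -- On words the identity is the inclusion–exclusion for the position of the cut relative to
      -- the junction of `u` and `v`.
      rw [← word_append, deconc_word, splitSum.append, deconc_word, deconc_word, splitSum.map,
        splitSum.map_apply]
      simp [TensorProduct.map₂_apply_tmul, word_append]
    | zero => simp
    | add x y hx hy => simp only [mul_add, map_add, hx, hy, TensorProduct.tmul_add]; abel
    | smul c x hx =>
      simp only [mul_smul_comm, map_smul, hx, TensorProduct.tmul_smul, smul_add, smul_sub]
  | zero => simp
  | add x y hx hy =>
    simp only [add_mul, map_add, hx, hy, TensorProduct.add_tmul, LinearMap.add_apply]; abel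
  | smul c x hx =>
    simp only [smul_mul_assoc, map_smul, hx, ← TensorProduct.smul_tmul', smul_add, smul_sub,
      LinearMap.smul_apply]

/-- An element of `T(R)` is its augmentation plus the sum over its coproduct of the products of the
letters of the left factor with the right factor. -/
theorem eq_augm_add_letters (x : TensorAlgebra K R) :
    x = augm K R x • 1 + TensorProduct.lift ((LinearMap.mul K (TensorAlgebra K R)).comp
      ((TensorAlgebra.ι K).comp (letters K R))) (deconc K R x) := by
  induction x using word_induction with
  | word u =>
    rw [augm_word, deconc_word, splitSum.map]
    simp only [TensorProduct.lift.tmul, LinearMap.comp_apply, LinearMap.mul_apply', letters_word]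
    -- Only the cut after the first letter has a left part of length one, and it restores the word.
    -- The empty word is accounted for by the augmentation.
    cases u with
    | nil => simp [splitSum.nil, letter, word_nil]
    | cons a u =>
      cases u with
      | nil => simp [splitSum.nil, splitSum.cons, letter, word]
      | cons b u => simp [splitSum.cons, letter, word_cons, splitSum.zero]
  | zero => simp
  | add x y hx hy =>
    conv_lhs => rw [hx, hy]
    simp only [map_add, add_smul]; abel
  | smul c x hx =>
    conv_lhs => rw [hx]
    simp only [map_smul, smul_add, smul_eq_mul, mul_smul]

/-- The counit law forces the augmentation of a primitive element to vanish. In the reconstruction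
of `x` from its coproduct, `1 ⊗ x` contributes nothing because `1` has no component in `R`, and `x ⊗
1` contributes the letter of `x`. -/
theorem exists_ι_of_deconc {x : TensorAlgebra K R}
    (hx : deconc K R x = x ⊗ₜ[K] 1 + 1 ⊗ₜ[K] x) : x = TensorAlgebra.ι K (letters K R x) := by
  have h0 : augm K R x = 0 := by
    have h := congrArg (augm K R) (augm_deconc x)
    rw [hx] at h
    simpa [augm_one] using h
  have h := eq_augm_add_letters x
  rw [hx, h0] at h
  simpa [letters_one] using h

theorem deconc_ι (a : R) : deconc K R (TensorAlgebra.ι K a) =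
    TensorAlgebra.ι K a ⊗ₜ[K] 1 + 1 ⊗ₜ[K] TensorAlgebra.ι K a := by
  rw [← word_singleton, deconc_word, splitSum.cons, splitSum.nil, word_nil, add_comm]

end Comul

end Tfc

/-! ## The product on words determined by operations on pairs of words -/

namespace Tfc

variable {K : Type u} {R : Type v} [Field K] [AddCommGroup R] [Module K R]

/-- The conditions on the operations `M_p0` and `M_0q` of a `B∞`-algebra. -/
structure IsUnitalOps (M : List R → List R → R) : Prop where
  nil_nil : M [] [] = 0
  singleton_nil : ∀ a, M [a] [] = a
  nil_singleton : ∀ a, M [] [a] = a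
  nil_right : ∀ u, 2 ≤ u.length → M u [] = 0
  nil_left : ∀ v, 2 ≤ v.length → M [] v = 0

variable (K) in
/-- The axioms of a `B∞`-algebra other than the relations `R_ijk`. -/
structure IsBlockOps (M : List R → List R → R) : Prop extends IsUnitalOps M where
  left : ∀ v, IsMultilin K fun u => M u v
  right : ∀ u, IsMultilin K (M u)

theorem _root_.BInfAlgebra.isBlockOps (P : BInfAlgebra K R) : IsBlockOps K P.M where
  left v l m := ⟨fun a b => P.M_add_left l m a b v, fun c a => P.M_smul_left l m c a v⟩
  right u l m := ⟨fun a b => P.M_add_right l m a b u, fun c a => P.M_smul_right l m c a u⟩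
  nil_nil := P.M_nil_nil
  singleton_nil := P.M_singleton_nil
  nil_singleton := P.M_nil_singleton
  nil_right := P.M_nil_right
  nil_left := P.M_nil_left

theorem IsUnitalOps.apply_nil {M : List R → List R → R} (hM : IsUnitalOps M) (u : List R) :
    M u [] = letter R u := by
  match u with
  | [] => exact hM.nil_nil
  | [a] => exact hM.singleton_nil a
  | a :: b :: u => exact hM.nil_right _ (by simp)

theorem IsUnitalOps.nil_apply {M : List R → List R → R} (hM : IsUnitalOps M) (u : List R) :
    M [] u = letter R u := by
  match u with
  | [] => exact hM.nil_nil
  | [a] => exact hM.nil_singleton a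
  | a :: b :: u => exact hM.nil_left _ (by simp)

section Words

variable (K) (M : List R → List R → R)

/-- The sum over all cuts of `(u, v)` of the words obtained by applying `M` to the blocks. -/
def cutProd (u v : List R) : TensorAlgebra K R :=
  ((allBlockCuts u v).map fun c => word K (blockWord M c)).sum

/-- The part of `cutProd` given by the cuts into `k` blocks. -/
def cutProdAux (k : ℕ) (u v : List R) : TensorAlgebra K R :=
  ((blockCuts k u v).map fun c => word K (blockWord M c)).sum

variable {M}

theorem cutProdAux_zero (u v : List R) :
    cutProdAux K M 0 u v = if u = [] ∧ v = [] then 1 else 0 := by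
  simp only [cutProdAux, blockCuts, Nat.add_eq_zero_iff, List.length_eq_zero_iff]
  split_ifs <;> simp [blockWord, word_nil]

/-- The first block is split off. Cuts omit the empty block, but since `M [] []` vanishes the sum
may run over all splittings. -/
theorem cutProdAux_succ (h0 : M [] [] = 0) (k : ℕ) (u v : List R) :
    cutProdAux K M (k + 1) u v = splitSum u fun a b => splitSum v fun c d =>
      TensorAlgebra.ι K (M a c) * cutProdAux K M k b d := by
  simp only [cutProdAux, blockCuts, sum_flatMap, splitSum]
  congr 2; funext i; congr 2; funext j
  split_ifs with h
  · obtain ⟨rfl, rfl⟩ := Nat.add_eq_zero_iff.mp h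
    simp [h0]
  · rw [List.map_map, ← List.sum_map_mul_left]
    simp [Function.comp_def, blockWord, word_cons]

/-- Each nonempty block uses up at least one letter. -/
theorem cutProdAux_eq_zero (h0 : M [] [] = 0) {k : ℕ} {u v : List R}
    (h : u.length + v.length < k) : cutProdAux K M k u v = 0 := by
  induction k generalizing u v with
  | zero => omega
  | succ k ih =>
    rw [cutProdAux_succ K h0]
    refine splitSum.eq_zero fun a b hab => splitSum.eq_zero fun c d hcd => ?_
    subst hab hcd
    simp only [List.length_append] at h
    by_cases hac : a = [] ∧ c = []
    · rw [hac.1, hac.2, h0, map_zero, zero_mul]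
    · rw [ih, mul_zero]
      rw [← List.length_eq_zero_iff, ← List.length_eq_zero_iff] at hac
      omega

/-- The freedom in the bound `n` lets pairs of words of different lengths be summed over the same
range of block numbers. -/
theorem cutProd_eq_sum (h0 : M [] [] = 0) {n : ℕ} {u v : List R} (h : u.length + v.length < n) :
    cutProd K M u v = ((List.range n).map fun k => cutProdAux K M k u v).sum := by
  obtain ⟨m, rfl⟩ := Nat.exists_eq_add_of_le (Nat.succ_le_of_lt h)
  rw [List.range_add, List.map_append, List.sum_append, List.map_map,
    List.sum_eq_zero (l := List.map _ (List.range m)), add_zero]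
  · exact sum_flatMap _ _ _
  · intro x hx
    obtain ⟨i, -, rfl⟩ := List.mem_map.mp hx
    exact cutProdAux_eq_zero K h0 (by simp only [Nat.succ_eq_add_one]; omega)

/-- The recursion behind all later computations: a nonempty cut is a first block followed by a cut
of what remains. -/
theorem cutProd_rec (h0 : M [] [] = 0) (u v : List R) :
    cutProd K M u v = (if u = [] ∧ v = [] then 1 else 0) +
      splitSum u fun a b => splitSum v fun c d => TensorAlgebra.ι K (M a c) * cutProd K M b d := by
  -- The bound exceeds the minimal one by one: after `k = 0` is removed, the range is still long
  -- enough for every remainder `(b, d)`, including `(u, v)` itself.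
  rw [cutProd_eq_sum K h0 (Nat.lt_succ_of_lt (Nat.lt_succ_self _)), List.range_succ_eq_map,
    List.map_cons, List.sum_cons, cutProdAux_zero, List.map_map]
  congr 1
  have h : (splitSum u fun a b => splitSum v fun c d =>
      TensorAlgebra.ι K (M a c) * cutProd K M b d) = splitSum u fun a b => splitSum v fun c d =>
      ((List.range (u.length + v.length + 1)).map fun k =>
        TensorAlgebra.ι K (M a c) * cutProdAux K M k b d).sum := by
    refine splitSum.congr fun a b hab => splitSum.congr fun c d hcd => ?_
    subst hab hcd
    rw [cutProd_eq_sum K h0 (n := (a ++ b).length + (c ++ d).length + 1), List.sum_map_mul_left]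
    simp only [List.length_append]; omega
  rw [h]
  generalize List.range (u.length + v.length + 1) = L
  induction L with
  | nil => simp [splitSum.zero]
  | cons k L ih =>
    simp only [List.map_cons, List.sum_cons, splitSum.add, ih, Function.comp_apply,
      Nat.succ_eq_add_one, cutProdAux_succ K h0]

theorem cutProd_nil_nil (h0 : M [] [] = 0) : cutProd K M [] [] = 1 := by
  rw [cutProd_rec K h0]; simp [splitSum.nil, h0]

/-- With one word empty, a block contributes only if it is a single letter, so the only surviving
cut is the one into letters. -/
theorem cutProd_nil (hM : IsUnitalOps M) (u : List R) : cutProd K M u [] = word K u := by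
  induction u with
  | nil => exact cutProd_nil_nil K hM.nil_nil
  | cons a u ih =>
    rw [cutProd_rec K hM.nil_nil]
    simp only [splitSum.nil, hM.apply_nil]
    cases u with
    | nil => simp [splitSum.cons, splitSum.nil, letter, ih, word_cons]
    | cons b u => simp [splitSum.cons, letter, ih, word_cons, splitSum.zero]

theorem nil_cutProd (hM : IsUnitalOps M) (u : List R) : cutProd K M [] u = word K u := by
  induction u with
  | nil => exact cutProd_nil_nil K hM.nil_nil
  | cons a u ih =>
    rw [cutProd_rec K hM.nil_nil]
    simp only [splitSum.nil, hM.nil_apply]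
    cases u with
    | nil => simp [splitSum.cons, splitSum.nil, letter, ih, word_cons]
    | cons b u => simp [splitSum.cons, letter, ih, word_cons, splitSum.zero]

theorem augm_cutProd (h0 : M [] [] = 0) (u v : List R) :
    augm K R (cutProd K M u v) = if u = [] ∧ v = [] then 1 else 0 := by
  rw [cutProd_rec K h0, map_add, splitSum.map]
  simp only [splitSum.map, augm_mul, augm_ι, zero_mul, splitSum.zero, add_zero]
  split_ifs <;> simp [augm_one]

/-- A word of length one comes only from the cut into a single block. -/
theorem letters_cutProd (h0 : M [] [] = 0) (u v : List R) :
    letters K R (cutProd K M u v) = M u v := by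
  rw [cutProd_rec K h0, map_add, splitSum.map]
  simp only [splitSum.map, letters_ι_mul, augm_cutProd K h0]
  rw [splitSum.eq_last, splitSum.eq_last]
  · split_ifs <;> simp_all [letters_one]
  · intro a b _ hb; simp [hb]
  · intro a b _ hb; simp [hb, splitSum.zero]

/-- Cutting a word of block values separates the blocks into an initial and a final family, that is,
into a cut of `(a, c)` and a cut of `(b, d)` with `u = ab`, `v = cd`. The proof is by induction on
the total length, through the recursion and `Δ(m · x) = 1 ⊗ m · x + (m ⊗ 1) · Δ(x)` for a letter
`m`. -/
theorem deconc_cutProd (h0 : M [] [] = 0) (u v : List R) :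
    deconc K R (cutProd K M u v) = splitSum u fun a b => splitSum v fun c d =>
      cutProd K M a c ⊗ₜ[K] cutProd K M b d := by
  induction hn : u.length + v.length using Nat.strong_induction_on generalizing u v with
  | _ n ih =>
  have key : ∀ a b, a ++ b = u → ∀ c d, c ++ d = v →
      deconc K R (TensorAlgebra.ι K (M a c) * cutProd K M b d) =
        1 ⊗ₜ[K] (TensorAlgebra.ι K (M a c) * cutProd K M b d) +
        splitSum b fun b₁ b₂ => splitSum d fun d₁ d₂ =>
          (TensorAlgebra.ι K (M a c) * cutProd K M b₁ d₁) ⊗ₜ[K] cutProd K M b₂ d₂ := by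
    rintro a b rfl c d rfl
    -- For an empty first block the remainder is not shorter, but the factor `M [] []` is zero.
    by_cases hac : a = [] ∧ c = []
    · simp [hac.1, hac.2, h0, splitSum.zero]
    · have hlt : b.length + d.length < n := by
        rw [← List.length_eq_zero_iff, ← List.length_eq_zero_iff] at hac
        simp only [List.length_append] at hn
        omega
      rw [deconc_mul, ih _ hlt _ _ rfl, deconc_ι]
      simp only [splitSum.map, map_add, LinearMap.add_apply, TensorProduct.map₂_apply_tmul,
        TensorProduct.map_tmul, LinearMap.mul_apply', one_mul, mul_one]
      abel
  conv_lhs => rw [cutProd_rec K h0]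
  rw [map_add, splitSum.map]
  simp only [splitSum.map]
  rw [splitSum.congr fun a b hab => splitSum.congr fun c d hcd => key a b hab c d hcd]
  simp only [splitSum.add]
  have h1 : (splitSum u fun a b => splitSum v fun c d =>
      (1 : TensorAlgebra K R) ⊗ₜ[K] (TensorAlgebra.ι K (M a c) * cutProd K M b d)) =
      1 ⊗ₜ[K] (cutProd K M u v - if u = [] ∧ v = [] then 1 else 0) := by
    rw [cutProd_rec K h0, add_sub_cancel_left, splitSum.tmul_left]
    simp only [splitSum.tmul_left]
  -- Coassociativity of the splittings of `u` and of `v` groups the first block with the middle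
  -- part, so that the recursion for the left tensor factor can be recognised. That recursion lacks
  -- only the term of the empty pair.
  have h2 : (splitSum u fun a b => splitSum v fun c d => splitSum b fun b₁ b₂ =>
        splitSum d fun d₁ d₂ =>
          (TensorAlgebra.ι K (M a c) * cutProd K M b₁ d₁) ⊗ₜ[K] cutProd K M b₂ d₂) =
      splitSum u fun a b => splitSum v fun c d =>
        (cutProd K M a c - if a = [] ∧ c = [] then 1 else 0) ⊗ₜ[K] cutProd K M b d := by
    calc _ = splitSum u fun a b => splitSum b fun b₁ b₂ => splitSum v fun c d =>
          splitSum d fun d₁ d₂ =>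
            (TensorAlgebra.ι K (M a c) * cutProd K M b₁ d₁) ⊗ₜ[K] cutProd K M b₂ d₂ :=
          splitSum.congr fun a b _ => splitSum.comm _ _ _
      _ = splitSum u fun a b => splitSum a fun a₁ a₂ => splitSum v fun c d =>
          splitSum d fun d₁ d₂ =>
            (TensorAlgebra.ι K (M a₁ c) * cutProd K M a₂ d₁) ⊗ₜ[K] cutProd K M b d₂ :=
          (splitSum.assoc u _).symm
      _ = splitSum u fun a b => splitSum a fun a₁ a₂ => splitSum v fun c d =>
          splitSum c fun c₁ c₂ =>
            (TensorAlgebra.ι K (M a₁ c₁) * cutProd K M a₂ c₂) ⊗ₜ[K] cutProd K M b d :=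
          splitSum.congr fun a b _ => splitSum.congr fun a₁ a₂ _ => (splitSum.assoc v _).symm
      _ = _ := by
        refine splitSum.congr fun a b _ => ?_
        rw [splitSum.comm]
        refine splitSum.congr fun c d _ => ?_
        rw [cutProd_rec K h0 a c, add_sub_cancel_left, splitSum.tmul_right]
        simp only [splitSum.tmul_right]
  rw [h1, h2]
  simp only [TensorProduct.sub_tmul, splitSum.sub]
  -- The correction in the left factor survives only at `a = c = []`; it cancels against the terms
  -- collected in `h1`.
  have h3 : (splitSum u fun a b => splitSum v fun c d =>
      (if a = [] ∧ c = [] then (1 : TensorAlgebra K R) else 0) ⊗ₜ[K] cutProd K M b d) =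
      1 ⊗ₜ[K] cutProd K M u v := by
    cases u <;> cases v <;> simp [splitSum.cons, splitSum.nil, splitSum.zero]
  rw [h3, TensorProduct.tmul_sub]
  split_ifs
  · rw [deconc_one]; abel
  · simp

theorem isMultilin_cutProdAux (hM : IsBlockOps K M) (k : ℕ) :
    (∀ v, IsMultilin K fun u => cutProdAux K M k u v) ∧
      ∀ u, IsMultilin K fun v => cutProdAux K M k u v := by
  induction k with
  | zero =>
    constructor <;> intro v l m <;> simp only [cutProdAux_zero] <;>
      exact ⟨by simp, by simp⟩
  | succ k ih =>
    simp only [cutProdAux_succ K hM.nil_nil]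
    constructor
    · intro v
      -- The letter that varies is either in the first block, where `M` is multilinear, or in the
      -- remainder, where the induction hypothesis applies.
      refine splitSum.isMultilin (fun b => IsMultilin.splitSum _ fun c d => ?_)
        fun a => IsMultilin.splitSum _ fun c d => ?_
      · exact ((hM.left c).comp (TensorAlgebra.ι K)).comp
          ((LinearMap.mul K (TensorAlgebra K R)).flip (cutProdAux K M k b d))
      · exact (ih.1 d).comp ((LinearMap.mul K _) (TensorAlgebra.ι K (M a c)))
    · intro u
      refine IsMultilin.splitSum _ fun a b => splitSum.isMultilin (fun d => ?_) fun c => ?_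
      · exact ((hM.right a).comp (TensorAlgebra.ι K)).comp
          ((LinearMap.mul K (TensorAlgebra K R)).flip (cutProdAux K M k b d))
      · exact (ih.2 b).comp ((LinearMap.mul K _) (TensorAlgebra.ι K (M a c)))

theorem isMultilin_cutProd_left (hM : IsBlockOps K M) (v : List R) :
    IsMultilin K fun u => cutProd K M u v := by
  intro l m
  simp only [fun x => cutProd_eq_sum K hM.nil_nil (Nat.lt_succ_self ((l ++ x :: m).length + v.length)),
    List.length_append, List.length_cons]
  exact isLinearMap_sum _ _ fun k => (isMultilin_cutProdAux K hM k).1 v l m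

theorem isMultilin_cutProd_right (hM : IsBlockOps K M) (u : List R) :
    IsMultilin K fun v => cutProd K M u v := by
  intro l m
  simp only [fun x => cutProd_eq_sum K hM.nil_nil (Nat.lt_succ_self (u.length + (l ++ x :: m).length)),
    List.length_append, List.length_cons]
  exact isLinearMap_sum _ _ fun k => (isMultilin_cutProdAux K hM k).2 u l m

end Words

end Tfc

/-! ## Associativity -/

namespace Tfc

variable {K : Type u} {R : Type v} [Field K] [AddCommGroup R] [Module K R]
variable {M : List R → List R → R} (hM : IsBlockOps K M)

/-- The product on `T(R)` determined by the operations `M`. -/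
def starProd : TensorAlgebra K R →ₗ[K] TensorAlgebra K R →ₗ[K] TensorAlgebra K R :=
  wordLift₂ (cutProd K M) (isMultilin_cutProd_left K hM) (isMultilin_cutProd_right K hM)

/-- The bilinear map on `T(R)` given on words by the operations `M`. -/
def ops : TensorAlgebra K R →ₗ[K] TensorAlgebra K R →ₗ[K] R :=
  wordLift₂ M hM.left hM.right

theorem starProd_word (u v : List R) : starProd hM (word K u) (word K v) = cutProd K M u v :=
  wordLift₂_word _ _ _ u v

theorem ops_word (u v : List R) : ops hM (word K u) (word K v) = M u v :=
  wordLift₂_word _ _ _ u v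

theorem letters_starProd (x y : TensorAlgebra K R) :
    letters K R (starProd hM x y) = ops hM x y := by
  have h : (starProd hM).compr₂ (letters K R) = ops hM := ext_word₂ fun u v => by
    rw [LinearMap.compr₂_apply, starProd_word, ops_word, letters_cutProd K hM.nil_nil]
  rw [← h, LinearMap.compr₂_apply]

theorem augm_starProd (x y : TensorAlgebra K R) :
    augm K R (starProd hM x y) = augm K R x * augm K R y := by
  have h : (starProd hM).compr₂ (augm K R) = (LinearMap.mul K K).compl₁₂ (augm K R) (augm K R) :=
    ext_word₂ fun u v => by
      rw [LinearMap.compr₂_apply, starProd_word, augm_cutProd K hM.nil_nil]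
      simp only [LinearMap.compl₁₂_apply, augm_word, LinearMap.mul_apply']
      split_ifs <;> simp_all
  exact LinearMap.congr_fun₂ h x y

theorem one_starProd (x : TensorAlgebra K R) : starProd hM 1 x = x := by
  have h : starProd hM 1 = LinearMap.id := ext_word fun u => by
    rw [← word_nil, starProd_word, nil_cutProd K hM.toIsUnitalOps, LinearMap.id_apply]
  rw [h, LinearMap.id_apply]

theorem starProd_one (x : TensorAlgebra K R) : starProd hM x 1 = x := by
  have h : (starProd hM).flip 1 = LinearMap.id := ext_word fun u => by
    rw [LinearMap.flip_apply, ← word_nil, starProd_word, cutProd_nil K hM.toIsUnitalOps, LinearMap.id_apply]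
  rw [← LinearMap.flip_apply, h, LinearMap.id_apply]

/-- This is the identity `deconc_cutProd`, extended bilinearly from words. -/
theorem deconc_starProd (x y : TensorAlgebra K R) :
    deconc K R (starProd hM x y) =
      TensorProduct.map₂ (starProd hM) (starProd hM) (deconc K R x) (deconc K R y) := by
  have h : (starProd hM).compr₂ (deconc K R) =
      (TensorProduct.map₂ (starProd hM) (starProd hM)).compl₁₂ (deconc K R) (deconc K R) :=
    ext_word₂ fun u v => by
      rw [LinearMap.compr₂_apply, starProd_word, deconc_cutProd K hM.nil_nil,
        LinearMap.compl₁₂_apply, deconc_word, deconc_word, splitSum.map_apply]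
      simp only [splitSum.map, TensorProduct.map₂_apply_tmul, TensorProduct.map_tmul,
        starProd_word]
  exact LinearMap.congr_fun₂ h x y

/-- The recursion for `*` made linear in its left argument: splittings of the left word are replaced
by the coproduct of `x`. It is needed for `x = u * v`, which is not a word. -/
theorem starProd_word_right_rec (x : TensorAlgebra K R) (w : List R) :
    starProd hM x (word K w) = augm K R (starProd hM x (word K w)) • 1 + splitSum w fun c d =>
      TensorProduct.lift ((LinearMap.mul K (TensorAlgebra K R)).compl₁₂
        ((TensorAlgebra.ι K).comp ((ops hM).flip (word K c))) ((starProd hM).flip (word K d)))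
        (deconc K R x) := by
  induction x using word_induction with
  | word u =>
    conv_lhs => rw [starProd_word, cutProd_rec K hM.nil_nil]
    rw [starProd_word, augm_cutProd K hM.nil_nil, deconc_word, splitSum.comm]
    simp only [splitSum.map, TensorProduct.lift.tmul, LinearMap.compl₁₂_apply,
      LinearMap.comp_apply, LinearMap.flip_apply, LinearMap.mul_apply', starProd_word, ops_word]
    split_ifs <;> simp
  | zero => simp [splitSum.zero]
  | add x y hx hy =>
    conv_lhs => rw [map_add, LinearMap.add_apply, hx, hy]
    simp only [map_add, LinearMap.add_apply, add_smul, splitSum.add]; abel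
  | smul c x hx =>
    conv_lhs => rw [map_smul, LinearMap.smul_apply, hx, smul_add]
    simp only [map_smul, LinearMap.smul_apply, smul_eq_mul, mul_smul]
    -- Multiplication by `c` is regarded as an additive map in order to move it inside the sum.
    rw [← DistribSMul.toAddMonoidHom_apply _ c (splitSum _ _), splitSum.map]
    rfl

/-- The mirror image, for the product of a word with `x = v * w`. -/
theorem starProd_word_left_rec (x : TensorAlgebra K R) (w : List R) :
    starProd hM (word K w) x = augm K R (starProd hM (word K w) x) • 1 + splitSum w fun c d =>
      TensorProduct.lift ((LinearMap.mul K (TensorAlgebra K R)).compl₁₂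
        ((TensorAlgebra.ι K).comp (ops hM (word K c))) (starProd hM (word K d)))
        (deconc K R x) := by
  induction x using word_induction with
  | word u =>
    conv_lhs => rw [starProd_word, cutProd_rec K hM.nil_nil]
    rw [starProd_word, augm_cutProd K hM.nil_nil, deconc_word]
    simp only [splitSum.map, TensorProduct.lift.tmul, LinearMap.compl₁₂_apply,
      LinearMap.comp_apply, LinearMap.mul_apply', starProd_word, ops_word]
    split_ifs <;> simp
  | zero => simp [splitSum.zero]
  | add x y hx hy =>
    conv_lhs => rw [map_add, hx, hy]
    simp only [map_add, add_smul, splitSum.add]; abel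
  | smul c x hx =>
    conv_lhs => rw [map_smul, hx, smul_add]
    simp only [map_smul, smul_eq_mul, mul_smul]
    rw [← DistribSMul.toAddMonoidHom_apply _ c (splitSum _ _), splitSum.map]
    rfl

/-- The left-hand side of the relation `R_ijk`. -/
def relLeft (u v w : List R) : R := ops hM (starProd hM (word K u) (word K v)) (word K w)

/-- The right-hand side of the relation `R_ijk`. -/
def relRight (u v w : List R) : R := ops hM (word K u) (starProd hM (word K v) (word K w))

theorem relLeft_eq (u v w : List R) :
    relLeft hM u v w = ((allBlockCuts u v).map fun c => M (blockWord M c) w).sum := by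
  rw [relLeft, starProd_word, cutProd, ← LinearMap.flip_apply, map_list_sum, List.map_map]
  simp only [Function.comp_def, LinearMap.flip_apply, ops_word]

theorem relRight_eq (u v w : List R) :
    relRight hM u v w = ((allBlockCuts v w).map fun c => M u (blockWord M c)).sum := by
  rw [relRight, starProd_word, cutProd, map_list_sum, List.map_map]
  simp only [Function.comp_def, ops_word]

/-- The recursion is applied to `u * v`, whose coproduct is the sum of the `(a * c) ⊗ (b * d)`; the
first letter formed with a prefix `e` of `w` is the left side of the relation for `(a, c, e)`. -/
theorem starProd_starProd_left (u v w : List R) :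
    starProd hM (starProd hM (word K u) (word K v)) (word K w) =
      (augm K R (word K u) * augm K R (word K v) * augm K R (word K w)) • 1 +
        splitSum u fun a b => splitSum v fun c d => splitSum w fun e f =>
          TensorAlgebra.ι K (relLeft hM a c e) *
            starProd hM (starProd hM (word K b) (word K d)) (word K f) := by
  conv_lhs => rw [starProd_word_right_rec, augm_starProd, augm_starProd, starProd_word hM u v,
    deconc_cutProd K hM.nil_nil]
  simp only [splitSum.map, TensorProduct.lift.tmul, LinearMap.compl₁₂_apply,
      LinearMap.comp_apply, LinearMap.flip_apply, LinearMap.mul_apply', ← starProd_word hM]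
  rw [splitSum.comm]
  simp only [splitSum.comm w]
  rfl

theorem starProd_starProd_right (u v w : List R) :
    starProd hM (word K u) (starProd hM (word K v) (word K w)) =
      (augm K R (word K u) * augm K R (word K v) * augm K R (word K w)) • 1 +
        splitSum u fun a b => splitSum v fun c d => splitSum w fun e f =>
          TensorAlgebra.ι K (relRight hM a c e) *
            starProd hM (word K b) (starProd hM (word K d) (word K f)) := by
  conv_lhs => rw [starProd_word_left_rec, augm_starProd, augm_starProd, starProd_word hM v w,
    deconc_cutProd K hM.nil_nil, ← mul_assoc]
  simp only [splitSum.map, TensorProduct.lift.tmul, LinearMap.compl₁₂_apply,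
      LinearMap.comp_apply, LinearMap.mul_apply', ← starProd_word hM]
  rfl

/-- If the relations `R_ijk` hold for shorter words, the associator of three words is the
difference of the two sides of the relation for these words. -/
theorem starProd_sub_starProd {n : ℕ}
    (h : ∀ u v w : List R, u.length + v.length + w.length < n →
      relLeft hM u v w = relRight hM u v w) (u v w : List R)
    (hn : u.length + v.length + w.length ≤ n) :
    starProd hM (starProd hM (word K u) (word K v)) (word K w) -
      starProd hM (word K u) (starProd hM (word K v) (word K w)) =
        TensorAlgebra.ι K (relLeft hM u v w - relRight hM u v w) := by
  induction n using Nat.strong_induction_on generalizing u v w with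
  | _ n ih =>
  -- For strictly shorter triples the relation itself is available, so the induction hypothesis says
  -- that they associate.
  have ih' : ∀ u v w : List R, u.length + v.length + w.length < n →
      starProd hM (starProd hM (word K u) (word K v)) (word K w) =
        starProd hM (word K u) (starProd hM (word K v) (word K w)) := fun u v w huvw => by
    rw [← sub_eq_zero, ih _ huvw (fun u' v' w' h' => h u' v' w' (h'.trans huvw)) u v w le_rfl,
      h u v w huvw, sub_self, map_zero]
  rw [starProd_starProd_left, starProd_starProd_right, add_sub_add_left_eq_sub]
  simp only [← splitSum.sub]
  -- Compared term by term, the two recursions differ only where the prefixes are the whole words.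
  -- Otherwise the first letters agree by hypothesis; if the prefixes are empty this letter is zero,
  -- and if not, the remainders are shorter and associate.
  have key : ∀ a b, a ++ b = u → ∀ c d, c ++ d = v → ∀ e f, e ++ f = w →
      TensorAlgebra.ι K (relLeft hM a c e) *
          starProd hM (starProd hM (word K b) (word K d)) (word K f) -
        TensorAlgebra.ι K (relRight hM a c e) *
          starProd hM (word K b) (starProd hM (word K d) (word K f)) =
      if b = [] ∧ d = [] ∧ f = [] then
        TensorAlgebra.ι K (relLeft hM a c e - relRight hM a c e) else 0 := by
    rintro a b rfl c d rfl e f rfl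
    simp only [List.length_append] at hn
    split_ifs with hbdf
    · obtain ⟨rfl, rfl, rfl⟩ := hbdf
      simp [word_nil, one_starProd]
    · simp only [← List.length_eq_zero_iff] at hbdf
      rw [h a c e (by omega)]
      by_cases hace : a = [] ∧ c = [] ∧ e = []
      · obtain ⟨rfl, rfl, rfl⟩ := hace
        have h0 : relRight hM [] [] [] = 0 := by
          rw [relRight, word_nil, one_starProd, ← word_nil, ops_word, hM.nil_nil]
        rw [h0, map_zero, zero_mul, zero_mul, sub_self]
      · simp only [← List.length_eq_zero_iff] at hace
        rw [ih' b d f (by omega), sub_self]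
  rw [splitSum.congr fun a b hab => splitSum.congr fun c d hcd => splitSum.congr fun e f hef =>
    key a b hab c d hcd e f hef]
  rw [splitSum.eq_last, splitSum.eq_last, splitSum.eq_last]
  · simp
  · intro a b _ hb; simp [hb]
  · intro a b _ hb; simp [hb, splitSum.zero]
  · intro a b _ hb; simp [hb, splitSum.zero]

/-- The product is associative as soon as the relations `R_ijk` hold. -/
theorem starProd_assoc
    (h : ∀ u v w : List R, relLeft hM u v w = relRight hM u v w) (x y z : TensorAlgebra K R) :
    starProd hM (starProd hM x y) z = starProd hM x (starProd hM y z) := by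
  induction x using word_induction with
  | word u =>
    induction y using word_induction with
    | word v =>
      induction z using word_induction with
      | word w =>
        rw [← sub_eq_zero, starProd_sub_starProd hM (fun u v w _ => h u v w) u v w le_rfl, h,
          sub_self, map_zero]
      | zero => simp
      | add x y hx hy => simp only [map_add, hx, hy]
      | smul c x hx => simp only [map_smul, hx]
    | zero => simp
    | add x y hx hy => simp only [map_add, LinearMap.add_apply, hx, hy]
    | smul c x hx => simp only [map_smul, LinearMap.smul_apply, hx]
  | zero => simp
  | add x y hx hy => simp only [map_add, LinearMap.add_apply, hx, hy]
  | smul c x hx => simp only [map_smul, LinearMap.smul_apply, hx]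

/-- The axioms of a `B∞`-algebra impose the relations only for nonempty words; the remaining ones
hold because the empty word is a unit for `*`. -/
theorem relLeft_eq_relRight_of_nil {u v w : List R} (h : u = [] ∨ v = [] ∨ w = []) :
    relLeft hM u v w = relRight hM u v w := by
  rcases h with rfl | rfl | rfl
  · simp only [relLeft, relRight, word_nil, one_starProd, ← letters_starProd]
  · simp only [relLeft, relRight, word_nil, one_starProd, starProd_one]
  · simp only [relLeft, relRight, word_nil, starProd_one, ← letters_starProd]

end Tfc

/-- `T^{fc}(R)` is a 2-associative bialgebra. -/
theorem tfc_isBialgebra {K : Type u} {R : Type v} [Field K] [AddCommGroup R] [Module K R]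
    (P : BInfAlgebra K R) : (tfc P).IsBialgebra := by
  have hs : (tfc P).star = Tfc.starProd P.isBlockOps := Tfc.ext_word₂ fun u v => by
    rw [tfc_star_word, Tfc.starProd_word]; rfl
  have hrel (u v w : List R) :
      Tfc.relLeft P.isBlockOps u v w = Tfc.relRight P.isBlockOps u v w := by
    by_cases h : u = [] ∨ v = [] ∨ w = []
    · exact Tfc.relLeft_eq_relRight_of_nil _ h
    · simp only [not_or] at h
      rw [Tfc.relLeft_eq, Tfc.relRight_eq]
      exact P.rel u v w h.1 h.2.1 h.2.2
  exact
    { star_assoc := fun a b c => by rw [hs]; exact Tfc.starProd_assoc _ hrel a b c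
      one_star := fun a => by rw [hs]; exact Tfc.one_starProd _ a
      star_one := fun a => by rw [hs]; exact Tfc.starProd_one _ a
      dot_assoc := mul_assoc
      one_dot := one_mul
      dot_one := mul_one
      coassoc := Tfc.deconc_coassoc
      counit_comul := Tfc.augm_deconc
      comul_counit := Tfc.deconc_augm
      comul_one := Tfc.deconc_one
      counit_one := Tfc.augm_one
      comul_star := fun x y => by rw [hs]; exact Tfc.deconc_starProd _ x y
      counit_star := fun x y => by rw [hs]; exact Tfc.augm_starProd _ x y
      comul_dot := Tfc.deconc_mul }

/-! ## The `B∞`-algebra of a 2-associative algebra -/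

namespace TwoAssocData

open Tfc

variable {K : Type u} {A : Type v} [Field K] [AddCommGroup A] [Module K A]
variable {O : TwoAssocData K A}

theorem dotProd_cons (a : A) (u : List A) : O.dotProd (a :: u) = O.dot a (O.dotProd u) := rfl

theorem dotProd_append (hO : O.IsAlgebra) (u v : List A) :
    O.dotProd (u ++ v) = O.dot (O.dotProd u) (O.dotProd v) := by
  induction u with
  | nil => exact (hO.one_dot _).symm
  | cons a u ih => rw [List.cons_append, dotProd_cons, dotProd_cons, ih, hO.dot_assoc]

theorem isMultilin_dotProd : IsMultilin K O.dotProd := by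
  intro l m
  induction l with
  | nil =>
    simp only [List.nil_append, dotProd_cons]
    exact ⟨fun x y => by rw [map_add, LinearMap.add_apply],
      fun c x => by rw [map_smul, LinearMap.smul_apply]⟩
  | cons a l ih =>
    simp only [List.cons_append, dotProd_cons]
    exact ⟨fun x y => by rw [ih.map_add, map_add], fun c x => by rw [ih.map_smul, map_smul]⟩

variable (O) in
/-- The linear map `T(A) → A` that multiplies the letters of a word. -/
def evalWord : TensorAlgebra K A →ₗ[K] A := wordLift O.dotProd isMultilin_dotProd

theorem evalWord_word (u : List A) : O.evalWord (word K u) = O.dotProd u := wordLift_word _ _ u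

theorem evalWord_ι (hO : O.IsAlgebra) (a : A) : O.evalWord (TensorAlgebra.ι K a) = a := by
  rw [← word_singleton, evalWord_word]
  exact hO.dot_one a

theorem evalWord_mul (hO : O.IsAlgebra) (x y : TensorAlgebra K A) :
    O.evalWord (x * y) = O.dot (O.evalWord x) (O.evalWord y) := by
  have h : (LinearMap.mul K (TensorAlgebra K A)).compr₂ O.evalWord =
      O.dot.compl₁₂ O.evalWord O.evalWord := ext_word₂ fun u v => by
    simp only [LinearMap.compr₂_apply, LinearMap.mul_apply', LinearMap.compl₁₂_apply,
      ← word_append, evalWord_word, dotProd_append hO]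
  exact LinearMap.congr_fun₂ h x y

theorem isUnitalOps : IsUnitalOps O.M where
  nil_nil := by rw [M]
  singleton_nil a := by rw [M]
  nil_singleton a := by rw [M]
  nil_right u hu := by
    match u with
    | _ :: _ :: _ => rw [M]
  nil_left u hu := by
    match u with
    | _ :: _ :: _ => rw [M]

/-- After the first block nothing may remain, so the block is the whole pair. -/
theorem sum_blockCuts_one {X : Type*} (g : List (List X × List X) → A) {u v : List X}
    (h : u.length + v.length ≠ 0) : ((blockCuts 1 u v).map g).sum = g [(u, v)] := by
  have h0 : ∀ a b c d : List X, ((if a.length + c.length = 0 then [] else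
      (blockCuts 0 b d).map fun e => (a, c) :: e).map g).sum =
      if b = [] ∧ d = [] ∧ a.length + c.length ≠ 0 then g [(a, c)] else 0 := by
    intro a b c d
    by_cases hbd : b = [] ∧ d = []
    · obtain ⟨rfl, rfl⟩ := hbd
      by_cases hac : a.length + c.length = 0
      · rw [if_pos hac, if_neg (by tauto)]; rfl
      · rw [if_neg hac, if_pos ⟨rfl, rfl, hac⟩]; simp [blockCuts]
    · have h1 : blockCuts 0 b d = [] := by
        rw [← List.length_eq_zero_iff, ← List.length_eq_zero_iff, ← Nat.add_eq_zero_iff] at hbd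
        rw [blockCuts, if_neg hbd]
      rw [h1, if_neg fun h : b = [] ∧ d = [] ∧ _ => hbd ⟨h.1, h.2.1⟩]
      simp
  have h1 : ((blockCuts 1 u v).map g).sum = splitSum u fun a b => splitSum v fun c d =>
      ((if a.length + c.length = 0 then [] else
        (blockCuts 0 b d).map fun e => (a, c) :: e).map g).sum := by
    rw [blockCuts]
    simp only [sum_flatMap, splitSum]
    congr 1
    refine List.map_congr_left fun i hi => ?_
    congr 1
    refine List.map_congr_left fun j hj => ?_
    rw [List.mem_range] at hi hj
    rw [List.length_take_of_le (by omega), List.length_take_of_le (by omega)]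
  rw [h1]
  simp only [h0]
  rw [splitSum.eq_last, splitSum.eq_last]
  · simp only [true_and, if_pos h]
  · intro a b _ hb; simp [hb]
  · intro a b _ hb; simp [hb, splitSum.zero]

/-- This separates the cut into one block from the cuts into at least two blocks, which are those
subtracted in the definition of `M_pq`. -/
theorem sum_allBlockCuts {X : Type*} (g : List (List X × List X) → A) {u v : List X}
    (hu : u ≠ []) (hv : v ≠ []) :
    ((allBlockCuts u v).map g).sum =
      g [(u, v)] + (((allBlockCuts u v).filter fun c => 2 ≤ c.length).map g).sum := by
  have hlu := List.length_pos_iff.mpr hu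
  have hlv := List.length_pos_iff.mpr hv
  -- Both words are nonempty, so the range of block numbers contains `0` and `1` and splits into `k
  -- < 2` and `k ≥ 2`.
  obtain ⟨n, hn⟩ : ∃ n, u.length + v.length + 1 = 2 + n := ⟨u.length + v.length - 1, by omega⟩
  have h2 : ∀ k, (blockCuts (2 + k) u v).filter (fun c => 2 ≤ c.length) =
      blockCuts (2 + k) u v := fun k => by
    rw [List.filter_eq_self]
    intro c hc
    have := ((mem_blockCuts _ _ _ _).mp hc).1
    simp only [decide_eq_true_eq]; omega
  have h1 : ∀ k, k < 2 → (blockCuts k u v).filter (fun c => 2 ≤ c.length) = [] := fun k hk => by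
    rw [List.filter_eq_nil_iff]
    intro c hc
    have := ((mem_blockCuts _ _ _ _).mp hc).1
    simp only [decide_eq_true_eq]; omega
  have h0 : blockCuts 0 u v = [] := by
    rw [blockCuts, if_neg (by omega)]
  rw [allBlockCuts, hn, List.range_add, List.filter_flatMap, List.flatMap_append,
    List.flatMap_append, List.map_append, List.map_append, List.sum_append, List.sum_append]
  simp only [List.flatMap_map, h2]
  rw [← add_assoc]
  congr 1
  simp [List.range_succ, h0, h1, sum_blockCuts_one g (u := u) (v := v) (by omega)]

/-- The inductive definition of `M_pq`, with the subtracted terms moved to the other side: the full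
sum over cuts, evaluated with `·`, is the product `*` in the algebra. -/
theorem evalWord_cutProd (hO : O.IsAlgebra) (u v : List A) :
    O.evalWord (cutProd K O.M u v) = O.star (O.dotProd u) (O.dotProd v) := by
  match u, v with
  | [], v => rw [nil_cutProd K isUnitalOps, evalWord_word]; exact (hO.one_star _).symm
  | u, [] => rw [cutProd_nil K isUnitalOps, evalWord_word]; exact (hO.star_one _).symm
  | a :: u, b :: v =>
    have h := O.M_cons_cons a b u v
    rw [cutProd, map_list_sum, List.map_map]
    simp only [Function.comp_def, evalWord_word]
    rw [sum_allBlockCuts _ (by simp) (by simp)]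
    have h1 : O.dotProd (blockWord O.M [(a :: u, b :: v)]) = O.M (a :: u) (b :: v) :=
      hO.dot_one _
    rw [h1, h, sub_add_cancel]

theorem star_dotProd_rec (hO : O.IsAlgebra) {u v : List A} (h : u.length + v.length ≠ 0) :
    O.star (O.dotProd u) (O.dotProd v) = splitSum u fun a b => splitSum v fun c d =>
      O.dot (O.M a c) (O.star (O.dotProd b) (O.dotProd d)) := by
  rw [← evalWord_cutProd hO, cutProd_rec K isUnitalOps.nil_nil, if_neg (by simp_all), zero_add,
    splitSum.map]
  simp only [splitSum.map, evalWord_mul hO, evalWord_ι hO, evalWord_cutProd hO]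

variable (O) in
/-- The operations `M_pq` with `p + q < n`. -/
def truncM (n : ℕ) (u v : List A) : A := if u.length + v.length < n then O.M u v else 0

/-- In the recursion for the product, `M u v` occurs only in the term whose first block is the whole
pair, and the truncation removes exactly that term. The result expresses `M u v` through shorter
words and serves to prove multilinearity. -/
theorem M_eq_sub (hO : O.IsAlgebra) {u v : List A} (h : u.length + v.length ≠ 0) :
    O.M u v = O.star (O.dotProd u) (O.dotProd v) -
      splitSum u fun a b => splitSum v fun c d =>
        O.dot (O.truncM (u.length + v.length) a c) (O.star (O.dotProd b) (O.dotProd d)) := by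
  rw [star_dotProd_rec hO h]
  simp only [← splitSum.sub, ← LinearMap.sub_apply, ← map_sub]
  have key : ∀ a b, a ++ b = u → ∀ c d, c ++ d = v →
      O.dot (O.M a c - O.truncM (u.length + v.length) a c)
        (O.star (O.dotProd b) (O.dotProd d)) = if b = [] ∧ d = [] then O.M a c else 0 := by
    rintro a b rfl c d rfl
    rw [truncM]
    split_ifs with h1 h2 h2
    · simp [h2] at h1
    · simp
    · rw [h2.1, h2.2, sub_zero]
      change O.dot _ (O.star O.one O.one) = _
      rw [hO.one_star, hO.dot_one]
    · simp only [← List.length_eq_zero_iff] at h2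
      simp only [List.length_append] at h1
      omega
  rw [splitSum.congr fun a b hab => splitSum.congr fun c d hcd => key a b hab c d hcd,
    splitSum.eq_last, splitSum.eq_last]
  · simp
  · intro a b _ hb; simp [hb]
  · intro a b _ hb; simp [hb, splitSum.zero]

/-- Multilinearity of sums over splittings needs a function defined and multilinear on all words.
The truncation of `M` provides one at each stage: on words of total length `m < n`, `M_eq_sub`
involves only the truncation at `m`, to which the induction hypothesis applies. -/
theorem isMultilin_truncM (hO : O.IsAlgebra) (n : ℕ) :
    (∀ v, IsMultilin K fun u => O.truncM n u v) ∧ ∀ u, IsMultilin K (O.truncM n u) := by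
  have hsub : ∀ {f g : A → A}, IsLinearMap K f → IsLinearMap K g →
      IsLinearMap K fun x => f x - g x := fun hf hg =>
    ⟨fun x y => by rw [hf.map_add, hg.map_add]; abel,
      fun c x => by rw [hf.map_smul, hg.map_smul, smul_sub]⟩
  have hzero : IsLinearMap K fun _ : A => (0 : A) := ⟨by simp, by simp⟩
  induction n using Nat.strong_induction_on with
  | _ n ih =>
  constructor
  · intro v l m
    -- Whether the truncation applies depends only on lengths, so not on the letter that varies.
    by_cases hlt : l.length + (m.length + 1) + v.length < n
    · simp only [truncM, List.length_append, List.length_cons, if_pos hlt]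
      have e : ∀ x, (l ++ x :: m).length + v.length ≠ 0 := by simp
      simp only [fun x => M_eq_sub hO (e x)]
      refine hsub ((isMultilin_dotProd.comp (O.star.flip (O.dotProd v))) l m) ?_
      simp only [List.length_append, List.length_cons]
      refine splitSum.isMultilin (K := K) (fun b => IsMultilin.splitSum _ fun c d => ?_)
        (fun a => IsMultilin.splitSum _ fun c d => ?_) l m
      · exact ((ih _ hlt).1 c).comp (O.dot.flip (O.star (O.dotProd b) (O.dotProd d)))
      · exact isMultilin_dotProd.comp ((O.dot _).comp (O.star.flip (O.dotProd d)))
    · simp only [truncM, List.length_append, List.length_cons, if_neg hlt]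
      exact hzero
  · intro u l m
    by_cases hlt : u.length + (l.length + (m.length + 1)) < n
    · simp only [truncM, List.length_append, List.length_cons, if_pos hlt]
      have e : ∀ x, u.length + (l ++ x :: m).length ≠ 0 := by simp
      simp only [fun x => M_eq_sub hO (e x)]
      refine hsub ((isMultilin_dotProd.comp (O.star (O.dotProd u))) l m) ?_
      simp only [List.length_append, List.length_cons]
      refine (IsMultilin.splitSum (K := K) _ fun a b => splitSum.isMultilin (fun d => ?_)
        fun c => ?_) l m
      · exact ((ih _ hlt).2 a).comp (O.dot.flip (O.star (O.dotProd b) (O.dotProd d)))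
      · exact isMultilin_dotProd.comp ((O.dot _).comp (O.star (O.dotProd b)))
    · simp only [truncM, List.length_append, List.length_cons, if_neg hlt]
      exact hzero

theorem isBlockOps (hO : O.IsAlgebra) : IsBlockOps K O.M where
  __ := isUnitalOps
  left v l m := by
    -- With a bound one larger than the total length, truncation has no effect.
    have h := (isMultilin_truncM hO (l.length + (m.length + 1) + v.length + 1)).1 v l m
    simpa [truncM] using h
  right u l m := by
    have h := (isMultilin_truncM hO (u.length + (l.length + (m.length + 1)) + 1)).2 u l m
    simpa [truncM] using h

theorem evalWord_starProd (hO : O.IsAlgebra) (x y : TensorAlgebra K A) :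
    O.evalWord (starProd (isBlockOps hO) x y) = O.star (O.evalWord x) (O.evalWord y) := by
  have h : (starProd (isBlockOps hO)).compr₂ O.evalWord = O.star.compl₁₂ O.evalWord O.evalWord :=
    ext_word₂ fun u v => by
      simp only [LinearMap.compr₂_apply, LinearMap.compl₁₂_apply, starProd_word,
        evalWord_cutProd hO, evalWord_word]
  exact LinearMap.congr_fun₂ h x y

/-- By induction the relations hold for shorter words, so the associator in `T(A)` is the letter
`relLeft - relRight`. Evaluation in `A` sends the associator to that of `*`, which is zero, and
sends the letter to itself. -/
theorem relLeft_eq_relRight (hO : O.IsAlgebra) (u v w : List A) :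
    relLeft (isBlockOps hO) u v w = relRight (isBlockOps hO) u v w := by
  induction hn : u.length + v.length + w.length using Nat.strong_induction_on
    generalizing u v w with
  | _ n ih =>
  have h := congrArg O.evalWord (starProd_sub_starProd (isBlockOps hO) (n := n)
    (fun u v w h => ih _ h u v w rfl) u v w hn.le)
  rw [map_sub, evalWord_ι hO] at h
  simp only [evalWord_starProd hO, hO.star_assoc, sub_self] at h
  exact (sub_eq_zero.mp h.symm)

/-- The `B∞`-algebra of a 2-associative algebra. -/
def bInf (hO : O.IsAlgebra) : BInfAlgebra K A where
  M := O.M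
  M_add_left l m a b v := ((isBlockOps hO).left v l m).map_add a b
  M_smul_left l m c a v := ((isBlockOps hO).left v l m).map_smul c a
  M_add_right l m a b u := ((isBlockOps hO).right u l m).map_add a b
  M_smul_right l m c a u := ((isBlockOps hO).right u l m).map_smul c a
  M_nil_nil := isUnitalOps.nil_nil
  M_singleton_nil := isUnitalOps.singleton_nil
  M_nil_singleton := isUnitalOps.nil_singleton
  M_nil_right := isUnitalOps.nil_right
  M_nil_left := isUnitalOps.nil_left
  rel u v w _ _ _ := by
    rw [← relLeft_eq (isBlockOps hO), ← relRight_eq (isBlockOps hO)]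
    exact relLeft_eq_relRight hO u v w

end TwoAssocData

/-! ## Naturality of the operations -/

namespace TwoAssocData

open Tfc

variable {K : Type u} {A : Type v} [Field K] [AddCommGroup A] [Module K A]
variable {O : TwoAssocData K A}

/-- The operations of a 2-associative algebra are characterised by the expansion of the product
`(u₁ · … · u_p) * (v₁ · … · v_q)`. -/
theorem M_map_eq {R : Type w} [AddCommGroup R] [Module K R] (hO : O.IsAlgebra) (j : R →ₗ[K] A)
    {M : List R → List R → R} (hM : IsUnitalOps M)
    (h : ∀ u v, ((allBlockCuts u v).map fun c => O.dotProd ((blockWord M c).map j)).sum =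
      O.star (O.dotProd (u.map j)) (O.dotProd (v.map j))) (u v : List R) :
    O.M (u.map j) (v.map j) = j (M u v) := by
  have hletter (u : List R) : letter A (u.map j) = j (letter R u) := by
    match u with
    | [] => exact (map_zero j).symm
    | [a] => rfl
    | a :: b :: u => exact (map_zero j).symm
  induction hn : u.length + v.length using Nat.strong_induction_on generalizing u v with
  | _ n ih =>
  match u, v with
  | [], v => rw [List.map_nil, isUnitalOps.nil_apply, hM.nil_apply, hletter]
  | u, [] => rw [List.map_nil, isUnitalOps.apply_nil, hM.apply_nil, hletter]
  | a :: u, b :: v =>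
    have h1 := h (a :: u) (b :: v)
    rw [sum_allBlockCuts _ (by simp) (by simp)] at h1
    have h2 : O.dotProd ((blockWord M [(a :: u, b :: v)]).map j) = j (M (a :: u) (b :: v)) :=
      hO.dot_one _
    have h3 := O.M_cons_cons (j a) (j b) (u.map j) (v.map j)
    simp only [← List.map_cons] at h3
    -- The cuts of the image words are the images of the cuts. After the one-block term is isolated,
    -- it remains to compare the cuts into at least two blocks, all of whose blocks are shorter.
    rw [allBlockCuts_map, List.filter_map, List.map_map, ← h1, h2] at h3
    rw [h3, sub_eq_iff_eq_add]
    congr 2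
    have h4 : ((fun c : List (List A × List A) => decide (2 ≤ c.length)) ∘
        List.map (Prod.map (List.map j) (List.map j))) = fun c => decide (2 ≤ c.length) := by
      funext c; simp
    rw [h4]
    refine List.map_congr_left fun c hc => ?_
    obtain ⟨hc, hc2⟩ := List.mem_filter.mp hc
    rw [Function.comp_apply, blockWord, blockWord, List.map_map, List.map_map]
    refine congrArg _ (List.map_congr_left fun x hx => ?_)
    exact (ih _ (hn ▸ length_lt_of_mem_allBlockCuts hc (by simpa using hc2) hx) _ _ rfl).symm

theorem IsHom.map_dotProd {B : Type w} [AddCommGroup B] [Module K B] {P : TwoAssocData K B}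
    {f : A →ₗ[K] B} (hf : O.IsHom P f) (u : List A) : f (O.dotProd u) = P.dotProd (u.map f) := by
  induction u with
  | nil => exact hf.map_one
  | cons a u ih => rw [List.map_cons, dotProd_cons, dotProd_cons, hf.map_dot, ih]

/-- The image under `f` of the expansion of the product in `A` is an expansion in the target, and
such an expansion determines the operations there. -/
theorem IsHom.map_M {B : Type w} [AddCommGroup B] [Module K B] {P : TwoAssocData K B}
    {f : A →ₗ[K] B} (hf : O.IsHom P f) (hO : O.IsAlgebra) (hP : P.IsAlgebra) (u v : List A) :
    f (O.M u v) = P.M (u.map f) (v.map f) := by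
  refine (M_map_eq hP f isUnitalOps (fun u v => ?_) u v).symm
  rw [← hf.map_dotProd, ← hf.map_dotProd, ← hf.map_star, ← evalWord_cutProd hO, cutProd,
    map_list_sum, map_list_sum, List.map_map, List.map_map]
  simp only [Function.comp_def, evalWord_word, hf.map_dotProd]

theorem IsHom.comp {B : Type*} {C : Type*} [AddCommGroup B] [Module K B] [AddCommGroup C]
    [Module K C] {P : TwoAssocData K B} {Q : TwoAssocData K C} {g : B →ₗ[K] C} {f : A →ₗ[K] B}
    (hg : P.IsHom Q g) (hf : O.IsHom P f) : O.IsHom Q (g.comp f) where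
  map_one := by rw [LinearMap.comp_apply, hf.map_one, hg.map_one]
  map_star a b := by simp only [LinearMap.comp_apply, hf.map_star, hg.map_star]
  map_dot a b := by simp only [LinearMap.comp_apply, hf.map_dot, hg.map_dot]

end TwoAssocData

/-! ### Extension of `B∞`-homomorphisms to `T^{fc}(R)` -/

namespace Tfc

variable {K : Type u} {R : Type v} [Field K] [AddCommGroup R] [Module K R] (P : BInfAlgebra K R)

theorem dotProd_map_ι (u : List R) :
    (tfc P).dotProd (u.map (TensorAlgebra.ι K)) = word K u := by
  induction u with
  | nil => rfl
  | cons a u ih =>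
    rw [List.map_cons, TwoAssocData.dotProd_cons, ih, word_cons]
    rfl

/-- The embedding of `R` in `T^{fc}(R)` is a `B∞`-homomorphism: the formula defining `*` on words is
precisely the expansion that characterises the operations `M_pq` of `T^{fc}(R)`. -/
theorem M_map_ι (u v : List R) :
    (tfc P).M (u.map (TensorAlgebra.ι K)) (v.map (TensorAlgebra.ι K)) =
      TensorAlgebra.ι K (P.M u v) := by
  refine TwoAssocData.M_map_eq (tfc_isBialgebra P).toIsAlgebra _ P.isBlockOps.toIsUnitalOps
    (fun u v => ?_) u v
  simp only [dotProd_map_ι, tfc_star_word]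

/-- The homomorphism `T^{fc}(R) → A` that extends a homomorphism from `R` to the `B∞`-algebra of
the 2-associative algebra `A`. -/
def extend {A : Type w} [AddCommGroup A] [Module K A] (O : TwoAssocData K A) (f : R →ₗ[K] A) :
    TensorAlgebra K R →ₗ[K] A :=
  wordLift (fun u => O.dotProd (u.map f)) fun l m => by
    have h := TwoAssocData.isMultilin_dotProd (O := O) (l.map f) (m.map f)
    simp only [List.map_append, List.map_cons]
    exact ⟨fun x y => by rw [map_add, h.map_add], fun c x => by rw [map_smul, h.map_smul]⟩

theorem extend_word {A : Type w} [AddCommGroup A] [Module K A] (O : TwoAssocData K A)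
    (f : R →ₗ[K] A) (u : List R) : extend O f (word K u) = O.dotProd (u.map f) :=
  wordLift_word _ _ u

/-- For `*`, both sides expand over the same cuts, and `f` carries the value of each block in `R` to
its value in `A`. For `·`, concatenation becomes the product of the two values. -/
theorem extend_isHom {A : Type w} [AddCommGroup A] [Module K A] {O : TwoAssocData K A}
    (hO : O.IsAlgebra) {f : R →ₗ[K] A} (hf : P.IsHom (TwoAssocData.bInf hO) f) :
    (tfc P).toTwoAssocData.IsHom O (extend O f) where
  map_one := extend_word O f []
  map_star x y := by
    have h : (tfc P).star.compr₂ (extend O f) = O.star.compl₁₂ (extend O f) (extend O f) :=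
      ext_word₂ fun u v => by
        rw [LinearMap.compr₂_apply, LinearMap.compl₁₂_apply, tfc_star_word, map_list_sum,
          extend_word, extend_word, ← TwoAssocData.evalWord_cutProd hO, cutProd, map_list_sum,
          allBlockCuts_map, List.map_map, List.map_map, List.map_map]
        refine congrArg _ (List.map_congr_left fun c _ => ?_)
        simp only [Function.comp_apply, extend_word, TwoAssocData.evalWord_word, blockWord,
          List.map_map]
        exact congrArg _ (List.map_congr_left fun b _ => hf b.1 b.2)
    exact LinearMap.congr_fun₂ h x y
  map_dot x y := by
    have h : (tfc P).dot.compr₂ (extend O f) = O.dot.compl₁₂ (extend O f) (extend O f) :=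
      ext_word₂ fun u v => by
        rw [LinearMap.compr₂_apply, LinearMap.compl₁₂_apply, extend_word, extend_word,
          ← TwoAssocData.dotProd_append hO, ← List.map_append, ← extend_word, word_append]
        rfl
    exact LinearMap.congr_fun₂ h x y

end Tfc

/-! ### Transfer of structures along injections and isomorphisms -/

/-- Operations on a space that embeds into a `B∞`-algebra compatibly with the operations satisfy
the axioms of a `B∞`-algebra. -/
def BInfAlgebra.ofInjective {K : Type u} {R : Type v} {S : Type w} [Field K] [AddCommGroup R]
    [Module K R] [AddCommGroup S] [Module K S] (P : BInfAlgebra K R) (j : S →ₗ[K] R)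
    (hj : Function.Injective j) (M : List S → List S → S)
    (hM : ∀ u v, j (M u v) = P.M (u.map j) (v.map j)) : BInfAlgebra K S where
  M := M
  M_add_left l m a b v := hj (by simp [hM, P.M_add_left])
  M_smul_left l m c a v := hj (by simp [hM, P.M_smul_left])
  M_add_right l m a b u := hj (by simp [hM, P.M_add_right])
  M_smul_right l m c a u := hj (by simp [hM, P.M_smul_right])
  M_nil_nil := hj (by simp [hM, P.M_nil_nil])
  M_singleton_nil a := hj (by simp [hM, P.M_singleton_nil])
  M_nil_singleton a := hj (by simp [hM, P.M_nil_singleton])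
  M_nil_right u hu := hj (by
    rw [hM, map_zero]
    exact P.M_nil_right _ (by simpa using hu))
  M_nil_left u hu := hj (by
    rw [hM, map_zero]
    exact P.M_nil_left _ (by simpa using hu))
  rel u v w hu hv hw := hj (by
    have h := P.rel (u.map j) (v.map j) (w.map j) (by simpa using hu) (by simpa using hv)
      (by simpa using hw)
    have hb (c : List (List S × List S)) : blockWord P.M
        (c.map (Prod.map (List.map j) (List.map j))) = (blockWord M c).map j := by
      simp [blockWord, hM]
    rw [allBlockCuts_map, allBlockCuts_map, List.map_map, List.map_map] at h
    rw [map_list_sum, map_list_sum, List.map_map, List.map_map]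
    simpa only [Function.comp_def, hM, hb] using h)

namespace FreeTwoAssoc

variable {K : Type u} {V : Type v} [Field K] [AddCommGroup V] [Module K V]

theorem map_map₂ {A : Type w} [AddCommGroup A] [Module K A]
    {m : FreeTwoAssoc K V →ₗ[K] FreeTwoAssoc K V →ₗ[K] FreeTwoAssoc K V}
    {n : A →ₗ[K] A →ₗ[K] A} {φ : FreeTwoAssoc K V →ₗ[K] A}
    (h : ∀ a b, φ (m a b) = n (φ a) (φ b)) (x y : FreeTwoAssoc K V ⊗[K] FreeTwoAssoc K V) :
    TensorProduct.map φ φ (TensorProduct.map₂ m m x y) =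
      TensorProduct.map₂ n n (TensorProduct.map φ φ x) (TensorProduct.map φ φ y) := by
  induction x with
  | zero => simp
  | add x x' hx hx' => simp only [map_add, LinearMap.add_apply, hx, hx']
  | tmul a a' =>
    induction y with
    | zero => simp
    | add y y' hy hy' => simp only [map_add, hy, hy']
    | tmul b b' => simp [TensorProduct.map₂_apply_tmul, h]

/-- A homomorphism of 2-associative algebras from `2as(V)` to a 2-associative bialgebra that maps
`V` to primitive elements is a homomorphism of bialgebras. -/
theorem isHom_of_map_ι_mem_prim {H : Type w} [AddCommGroup H] [Module K H]
    {B : TwoAssocBialgData K H} (hB : B.IsBialgebra) {φ : FreeTwoAssoc K V →ₗ[K] H}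
    (hφ : (data K V).IsHom B.toTwoAssocData φ) (hι : ∀ x, φ (ι K V x) ∈ B.prim)
    (hε : ∀ x, B.counit (φ (ι K V x)) = 0)
    (hdot : ∀ x y, B.counit (B.dot x y) = B.counit x * B.counit y) : (bialgData K V).IsHom B φ where
  __ := hφ
  map_comul := by
    rintro ⟨a⟩
    change B.comul (φ (mk K V a)) = TensorProduct.map φ φ (Pre.comul a)
    -- The coproduct of `2as(V)` is defined by recursion on expressions; the laws of the target make
    -- its coproduct obey the same recursion.
    induction a with
    | of x =>
      refine (hι x).trans ?_
      simp only [Pre.comul, map_add, TensorProduct.map_tmul, hφ.map_one]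
    | zero => exact (congrArg _ (map_zero φ)).trans (by simp [Pre.comul])
    | add a b iha ihb => rw [mk_add, map_add, map_add, iha, ihb, Pre.comul, map_add]
    | smul c a ih => rw [mk_smul, map_smul, map_smul, ih, Pre.comul, map_smul]
    | one => rw [mk_one, hφ.map_one, hB.comul_one, Pre.comul, TensorProduct.map_tmul, hφ.map_one]
    | star a b iha ihb =>
      rw [mk_star, hφ.map_star, hB.comul_star, iha, ihb, Pre.comul, map_map₂ hφ.map_star]
    | dot a b iha ihb =>
      rw [mk_dot, hφ.map_dot, hB.comul_dot, iha, ihb, Pre.comul, map_sub, map_add,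
        map_map₂ hφ.map_dot, map_map₂ hφ.map_dot]
      simp only [TensorProduct.map_tmul, hφ.map_one]
  map_counit := by
    rintro ⟨a⟩
    change B.counit (φ (mk K V a)) = Pre.counit a
    induction a with
    | of x => exact hε x
    | zero => exact (congrArg _ (map_zero φ)).trans (map_zero _)
    | add a b iha ihb => rw [mk_add, map_add, map_add, iha, ihb]; rfl
    | smul c a ih => rw [mk_smul, map_smul, map_smul, ih]; rfl
    | one => rw [mk_one, hφ.map_one, hB.counit_one]; rfl
    | star a b iha ihb => rw [mk_star, hφ.map_star, hB.counit_star, iha, ihb]; rfl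
    -- Multiplicativity of the counit for `·` is not among the laws of `IsBialgebra`, whence the
    -- hypothesis `hdot`.
    | dot a b iha ihb => rw [mk_dot, hφ.map_dot, hdot, iha, ihb]; rfl

/-- If `2as(V)` is isomorphic to a 2-associative bialgebra, compatibly with the coproducts and
counits, then it is a 2-associative bialgebra. -/
theorem isBialgebra_of_equiv {H : Type w} [AddCommGroup H] [Module K H]
    {B : TwoAssocBialgData K H} (hB : B.IsBialgebra) (φ : FreeTwoAssoc K V ≃ₗ[K] H)
    (hφ : (bialgData K V).IsHom B φ.toLinearMap) : (bialgData K V).IsBialgebra where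
  __ := data_isAlgebra K V
  coassoc x := by
    have hl (t : FreeTwoAssoc K V ⊗[K] FreeTwoAssoc K V) :
        TensorProduct.map φ.toLinearMap (TensorProduct.map φ.toLinearMap φ.toLinearMap)
          (TensorProduct.assoc K _ _ _ ((bialgData K V).comul.rTensor _ t)) =
        TensorProduct.assoc K _ _ _ (B.comul.rTensor _
          (TensorProduct.map φ.toLinearMap φ.toLinearMap t)) := by
      induction t with
      | zero => simp
      | add s t hs ht => simp only [map_add, hs, ht]
      | tmul a b =>
        rw [TensorProduct.map_tmul, LinearMap.rTensor_tmul, LinearMap.rTensor_tmul, hφ.map_comul]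
        generalize (bialgData K V).comul a = s
        induction s with
        | zero => simp
        | add s t hs ht => simp only [map_add, TensorProduct.add_tmul, hs, ht]
        | tmul c d => simp
    have hr (t : FreeTwoAssoc K V ⊗[K] FreeTwoAssoc K V) :
        TensorProduct.map φ.toLinearMap (TensorProduct.map φ.toLinearMap φ.toLinearMap)
          ((bialgData K V).comul.lTensor _ t) =
        B.comul.lTensor _ (TensorProduct.map φ.toLinearMap φ.toLinearMap t) := by
      induction t with
      | zero => simp
      | add s t hs ht => simp only [map_add, hs, ht]
      | tmul a b =>
        rw [TensorProduct.map_tmul, LinearMap.lTensor_tmul, LinearMap.lTensor_tmul, hφ.map_comul,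
          TensorProduct.map_tmul]
    -- Since `φ ⊗ φ ⊗ φ` is injective, coassociativity may be checked in `H`.
    apply (TensorProduct.congr φ (TensorProduct.congr φ φ)).injective
    change TensorProduct.map φ.toLinearMap (TensorProduct.map φ.toLinearMap φ.toLinearMap) _ =
      TensorProduct.map φ.toLinearMap (TensorProduct.map φ.toLinearMap φ.toLinearMap) _
    rw [hl, hr, ← hφ.map_comul, hB.coassoc]
  counit_comul x := by
    have h (t : FreeTwoAssoc K V ⊗[K] FreeTwoAssoc K V) :
        φ (TensorProduct.lid K _ ((bialgData K V).counit.rTensor _ t)) =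
          TensorProduct.lid K _ (B.counit.rTensor _
            (TensorProduct.map φ.toLinearMap φ.toLinearMap t)) := by
      induction t with
      | zero => simp
      | add s t hs ht => simp only [map_add, hs, ht]
      | tmul a b =>
        rw [TensorProduct.map_tmul, LinearMap.rTensor_tmul, LinearMap.rTensor_tmul, hφ.map_counit]
        simp
    apply φ.injective
    rw [h, ← hφ.map_comul, hB.counit_comul]
    rfl
  comul_counit x := by
    have h (t : FreeTwoAssoc K V ⊗[K] FreeTwoAssoc K V) :
        φ (TensorProduct.rid K _ ((bialgData K V).counit.lTensor _ t)) =
          TensorProduct.rid K _ (B.counit.lTensor _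
            (TensorProduct.map φ.toLinearMap φ.toLinearMap t)) := by
      induction t with
      | zero => simp
      | add s t hs ht => simp only [map_add, hs, ht]
      | tmul a b =>
        rw [TensorProduct.map_tmul, LinearMap.lTensor_tmul, LinearMap.lTensor_tmul, hφ.map_counit]
        simp
    apply φ.injective
    rw [h, ← hφ.map_comul, hB.comul_counit]
    rfl
  -- The remaining laws are clauses of the recursive definitions of the coproduct and the counit on
  -- expressions.
  comul_one := rfl
  counit_one := rfl
  comul_star := by rintro ⟨a⟩ ⟨b⟩; rfl
  counit_star := by rintro ⟨a⟩ ⟨b⟩; rfl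
  comul_dot := by rintro ⟨a⟩ ⟨b⟩; rfl

end FreeTwoAssoc

/-! ### Homomorphisms from the free objects are determined on generators -/

theorem FreeBInf.hom_ext {K : Type u} {V : Type v} [Field K] [AddCommGroup V] [Module K V]
    {R : Type w} [AddCommGroup R] [Module K R] {P : BInfAlgebra K R} {f g : FreeBInf K V →ₗ[K] R}
    (hf : (FreeBInf.str K V).IsHom P f) (hg : (FreeBInf.str K V).IsHom P g)
    (h : ∀ x, f (FreeBInf.ι K V x) = g (FreeBInf.ι K V x)) : f = g :=
  (FreeBInf.existsUnique_lift P (g.comp (FreeBInf.ι K V))).unique ⟨hf, h⟩ ⟨hg, fun _ => rfl⟩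

theorem FreeTwoAssoc.hom_ext {K : Type u} {V : Type v} [Field K] [AddCommGroup V] [Module K V]
    {A : Type w} [AddCommGroup A] [Module K A] {O : TwoAssocData K A} (hO : O.IsAlgebra)
    {f g : FreeTwoAssoc K V →ₗ[K] A} (hf : (FreeTwoAssoc.data K V).IsHom O f)
    (hg : (FreeTwoAssoc.data K V).IsHom O g)
    (h : ∀ x, f (FreeTwoAssoc.ι K V x) = g (FreeTwoAssoc.ι K V x)) : f = g :=
  (FreeTwoAssoc.existsUnique_lift O hO (g.comp (FreeTwoAssoc.ι K V))).unique
    ⟨hf, h⟩ ⟨hg, fun _ => rfl⟩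

end

/-! ### The isomorphisms `φ` and `φbar` -/

theorem corollary4p4 {K : Type u} [Field K] (V : Type v) [AddCommGroup V] [Module K V] :
    (FreeTwoAssoc.bialgData K V).IsBialgebra ∧
    (tfc (FreeBInf.str K V)).IsBialgebra ∧
    ∃ P : BInfAlgebra K (FreeTwoAssoc.bialgData K V).prim,
      (∀ u v : List (FreeTwoAssoc.bialgData K V).prim,
        (P.M u v : FreeTwoAssoc K V) =
          (FreeTwoAssoc.data K V).M (u.map Subtype.val) (v.map Subtype.val)) ∧
      ∃ (φbar : (FreeTwoAssoc.bialgData K V).prim ≃ₗ[K] FreeBInf K V)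
        (φ : FreeTwoAssoc K V ≃ₗ[K] TensorAlgebra K (FreeBInf K V)),
        P.IsHom (FreeBInf.str K V) φbar.toLinearMap ∧
        (FreeTwoAssoc.bialgData K V).IsHom (tfc (FreeBInf.str K V)) φ.toLinearMap ∧
        (∀ x : V, φ (FreeTwoAssoc.ι K V x) = TensorAlgebra.ι K (FreeBInf.ι K V x)) ∧
        (∀ x : (FreeTwoAssoc.bialgData K V).prim,
          φ (x : FreeTwoAssoc K V) = TensorAlgebra.ι K (φbar x)) := by
  have hO := FreeTwoAssoc.data_isAlgebra K V
  have hT := tfc_isBialgebra (FreeBInf.str K V)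
  -- Here all of `2as(V)` is the target `B∞`-algebra; that `f` has values in the primitive elements
  -- is found only afterwards.
  obtain ⟨f, ⟨hf, hfι⟩, -⟩ :=
    FreeBInf.existsUnique_lift (TwoAssocData.bInf hO) (FreeTwoAssoc.ι K V)
  obtain ⟨F, ⟨hF, hFι⟩, -⟩ := FreeTwoAssoc.existsUnique_lift _ hT.toIsAlgebra
    ((TensorAlgebra.ι K).comp (FreeBInf.ι K V))
  -- Both sides are `B∞`-homomorphisms into `T^{fc}(B∞(V))` with its operations `M_pq`, and they
  -- agree on `V`.
  have hFf : F.comp f = TensorAlgebra.ι K := by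
    refine FreeBInf.hom_ext (P := TwoAssocData.bInf hT.toIsAlgebra) (fun u v => ?_)
      (fun u v => ?_) fun x => ?_
    · rw [LinearMap.comp_apply, hf]
      refine (hF.map_M hO hT.toIsAlgebra _ _).trans ?_
      rw [List.map_map, List.map_map]
      rfl
    · exact (Tfc.M_map_ι _ u v).symm
    · rw [LinearMap.comp_apply, hfι, hFι, LinearMap.comp_apply]
  have hFf' (q : FreeBInf K V) : F (f q) = TensorAlgebra.ι K q := LinearMap.congr_fun hFf q
  have hG := Tfc.extend_isHom (FreeBInf.str K V) hO hf
  have hGF : (Tfc.extend (FreeTwoAssoc.data K V) f).comp F = LinearMap.id := by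
    refine FreeTwoAssoc.hom_ext hO (hG.comp hF) ⟨rfl, fun _ _ => rfl, fun _ _ => rfl⟩ fun x => ?_
    rw [LinearMap.comp_apply, hFι, LinearMap.comp_apply, ← Tfc.word_singleton, Tfc.extend_word]
    refine (hO.dot_one _).trans ?_
    rw [hfι, LinearMap.id_apply]
  -- On a word, the extension multiplies the images of the letters under `f` with `·`, and `F`
  -- returns each image to its letter.
  have hFG : F.comp (Tfc.extend (FreeTwoAssoc.data K V) f) = LinearMap.id :=
    Tfc.ext_word fun u => by
      rw [LinearMap.comp_apply, Tfc.extend_word, hF.map_dotProd, List.map_map,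
        LinearMap.id_apply, ← Tfc.dotProd_map_ι (FreeBInf.str K V), ← hFf]
      rfl
  let φ : FreeTwoAssoc K V ≃ₗ[K] TensorAlgebra K (FreeBInf K V) :=
    LinearEquiv.ofLinearMap F (Tfc.extend (FreeTwoAssoc.data K V) f) hFG hGF
  have hφ : (FreeTwoAssoc.bialgData K V).IsHom (tfc (FreeBInf.str K V)) φ.toLinearMap :=
    FreeTwoAssoc.isHom_of_map_ι_mem_prim hT hF
      (fun x => by
        refine (congrArg _ (hFι x)).trans ?_
        refine (Tfc.deconc_ι _).trans ?_
        rw [← LinearMap.comp_apply, ← hFι]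
        rfl)
      (fun x => (congrArg _ (hFι x)).trans (Tfc.augm_ι _))
      Tfc.augm_mul
  have hprim (x : (FreeTwoAssoc.bialgData K V).prim) :
      F x = TensorAlgebra.ι K (Tfc.letters K _ (F x)) := by
    refine Tfc.exists_ι_of_deconc ?_
    refine (hφ.map_comul x).trans ?_
    rw [show (FreeTwoAssoc.bialgData K V).comul x = _ from x.2, map_add, TensorProduct.map_tmul,
      TensorProduct.map_tmul, hφ.map_one]
    rfl
  -- Primitivity of `f q` is tested after applying the injective map `φ ⊗ φ`, where it becomes
  -- primitivity of the letter `q`.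
  have hmem (q : FreeBInf K V) : f q ∈ (FreeTwoAssoc.bialgData K V).prim := by
    apply (TensorProduct.congr φ φ).injective
    refine (hφ.map_comul (f q)).symm.trans ?_
    refine (congrArg _ (hFf' q)).trans ((Tfc.deconc_ι q).trans ?_)
    rw [← hFf', map_add, TensorProduct.congr_tmul, TensorProduct.congr_tmul]
    change _ = F (f q) ⊗ₜ[K] F (FreeTwoAssoc.data K V).one +
      F (FreeTwoAssoc.data K V).one ⊗ₜ[K] F (f q)
    rw [hF.map_one]
    rfl
  -- The inverse is `f`, with its values restricted to the primitive elements.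
  let φbar : (FreeTwoAssoc.bialgData K V).prim ≃ₗ[K] FreeBInf K V :=
    LinearEquiv.ofLinearMap ((Tfc.letters K _).comp (F.comp (Submodule.subtype _)))
      (f.codRestrict _ hmem)
      (LinearMap.ext fun q => (congrArg _ (hFf' q)).trans (Tfc.letters_ι q))
      (LinearMap.ext fun x => Subtype.ext (φ.injective ((hFf' _).trans (hprim x).symm)))
  have hφbar (x : (FreeTwoAssoc.bialgData K V).prim) : f (φbar x) = x :=
    congrArg Subtype.val (φbar.symm_apply_apply x)
  have hM (u v : List (FreeTwoAssoc.bialgData K V).prim) :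
      f ((FreeBInf.str K V).M (u.map φbar) (v.map φbar)) =
        (FreeTwoAssoc.data K V).M (u.map Subtype.val) (v.map Subtype.val) := by
    rw [hf, List.map_map, List.map_map]
    simp only [Function.comp_def, hφbar]
    rfl
  -- The operations on the primitive elements are transported from `B∞(V)`, so their values are
  -- primitive by construction. By `hM` they are the restrictions of the operations of `2as(V)`,
  -- which gives closedness, and the axioms follow from those of `2as(V)`.
  refine ⟨FreeTwoAssoc.isBialgebra_of_equiv hT φ hφ, hT,
    (TwoAssocData.bInf hO).ofInjective (Submodule.subtype _) Subtype.val_injective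
      (fun u v => φbar.symm ((FreeBInf.str K V).M (u.map φbar) (v.map φbar))) hM, hM, φbar, φ,
    fun u v => φbar.apply_symm_apply _, hφ, hFι, hprim⟩
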